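/- **Theorem.** Let $B_n$ be the Bernoulli polynomials, defined by $\sum_{n\ge 0} B_n(x)\,t^n/n! = t e^{xt}/(e^t-1)$. Put $$\Gamma_+=\{z\in\mathbb C:\ \mathrm{Im}\,z>0,\ |z|\le \tfrac1{2\pi},\ e^{2\pi\,\mathrm{Im}\,z}=2\pi e|z|\},\qquad \Gamma_-=\{z\in\mathbb C:\ \mathrm{Im}\,z<0,\ |z|\le \tfrac1{2\pi},\ e^{-2\pi\,\mathrm{Im}\,z}=2\pi e|z|\}.$$ As $n\to\infty$, the non-real zeros of $B_n(nz)$ accumulate exactly on $\Gamma_+$ in the upper half-plane and exactly on $\Gamma_-$ in the lower half-plane, in the following sense. For every $\varepsilon>0$ there is an $N$ such that for all $n\ge N$: 1. every zero $z$ of $B_n(nz)$ with $\mathrm{Im}\,z>0$ is at distance less than $\varepsilon$ from some point of $\Gamma_+$, and every zero with $\mathrm{Im}\,z<0$ is at distance less than $\varepsilon$ from some point of $\Gamma_-$; 2. every point of $\Gamma_+$ is at distance less than $\varepsilon$ from some zero $z$ of $B_n(nz)$ with $\mathrm{Im}\,z>0$, and every point of $\Gamma_-$ is at distance less than $\varepsilon$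 from some zero with $\mathrm{Im}\,z<0$. -/

import Mathlib

/-- The set of all complex `z` that are zeros of the rescaled Bernoulli polynomial `B_n(n z)`. -/
def rescaledBernoulliZeros (n : ℕ) : Set ℂ :=
  {z : ℂ | Polynomial.aeval ((n : ℂ) * z) (Polynomial.bernoulli n) = 0}

/-- The arc of `e^{2π Im z} = 2π e |z|` in the open upper half-plane and in the closed disc of
radius `1 / (2π)`. -/
def upperZeroCurve : Set ℂ :=
  {z : ℂ | 0 < z.im ∧ ‖z‖ ≤ 1 / (2 * Real.pi) ∧
    Real.exp (2 * Real.pi * z.im) = 2 * Real.pi * Real.exp 1 * ‖z‖}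

/-- The arc of `e^{-2π Im z} = 2π e |z|` in the open lower half-plane and in the closed disc of
radius `1 / (2π)`. -/
def lowerZeroCurve : Set ℂ :=
  {z : ℂ | z.im < 0 ∧ ‖z‖ ≤ 1 / (2 * Real.pi) ∧
    Real.exp (-(2 * Real.pi * z.im)) = 2 * Real.pi * Real.exp 1 * ‖z‖}

/-! Put `s = -2πiz`, so that up to a nonzero constant `B_n(nz)` becomes `bernSum n s`, the sum of
`g_k (ns)^(n-k)/(n-k)!`, where the `g_k` are the Taylor coefficients of `G(v) = t/(e^t - 1)` with `t
= -2πiv`. The poles of `G` are the nonzero integers. Each of the poles `±1`, `±2` contributes a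
truncated exponential to `bernSum`. Once these four are removed, the coefficients are `O(3^(-k))`.

A truncated exponential of degree `n` at `nσ` is close to `T/(1 - 1/σ)` for `|σ| ≥ 1`, and to
`e^(nσ) + T/(1 - 1/σ)` for `|σ| ≤ 1`, where `T = (nσ)^n/n!`. The terms in `T` reassemble the
principal parts of `G`. Hence, with `T = (ns)^n/n!`, `bernSum n s` is close to `T·G(1/s)` outside
the unit disc; inside, away from `0` and the poles of `G(1/s)`, it is close to `T·G(1/s) - (e^(ns) +
(-1)^n e^(-ns))`. Since `G` has no zeros where it is needed, and `|T|` is `(e|s|)^n` up to a factor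
`O(√n)`, a zero with `Re s > 0` forces the two terms to balance: `e|s| = e^(Re s)`, the Szegő curve.

Zeros lie near the curve: at height `|s e^(1-s)| > 1` the term `T·G(1/s)` dominates, and at height
below `1` the exponentials do. The delicate region is next to the imaginary axis, where the two
exponentials cancel and produce the real zeros of `B_n`. There `bernSum_ne_zero_of_approx` plays a
zero against its mirror image `-conj s`.

Zeros approach the whole curve: near `p ≠ 1` on it, taking logarithms of the balance equation gives
`log s - s + O(1/n) = y` with `y` within `o(1)` of `log p - p`, which is solvable by a quantitative
open mapping theorem. Compactness makes this uniform, the tip `s = 1` is a limit of other points,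
and complex conjugation gives the lower half-plane. -/

section

open Finset Filter Topology

/-! ### Power series with slowly decaying coefficients -/

/-- A sequence decreasing from `1` to `0` on the scale `√n`, with controlled second differences. -/
structure SlowDecay (n : ℕ) (c : ℕ → ℝ) : Prop where
  zero : c 0 = 1
  nonneg : ∀ j, 0 ≤ c j
  anti : ∀ j, c (j + 1) ≤ c j
  moment : ∀ N, ∑ j ∈ range N, (j : ℝ) * c j ≤ n
  diff_zero : c 0 - c 1 ≤ 1 / n
  second_diff : ∀ j, |(c (j + 1) - c (j + 2)) - (c j - c (j + 1))| ≤
    (c j + (j + 1) * (c j - c (j + 1)) + (c (j + 1) + (j + 2) * (c (j + 1) - c (j + 2)))) / n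

namespace SlowDecay

variable {n : ℕ} {c : ℕ → ℝ}

lemma le_one (h : SlowDecay n c) (j : ℕ) : c j ≤ 1 := by
  induction j with
  | zero => exact h.zero.le
  | succ j ih => exact (h.anti j).trans ih

/-- Split at `j = √n`: the earlier terms are at most `1`, and each later one is at most `j c_j /
√n`, which the moment bound controls. -/
lemma sum_range_le (h : SlowDecay n c) (hn : 1 ≤ n) (N : ℕ) :
    ∑ j ∈ range N, c j ≤ 3 * √n := by
  have hn' : (1 : ℝ) ≤ n := by exact_mod_cast hn
  have hs : 1 ≤ √(n : ℝ) := Real.one_le_sqrt.2 hn'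
  have hs2 : √(n : ℝ) * √n = n := Real.mul_self_sqrt (by positivity)
  set J := ⌈√(n : ℝ)⌉₊ with hJ
  have hJ1 : √(n : ℝ) ≤ J := Nat.le_ceil _
  have hJ2 : (J : ℝ) < √n + 1 := Nat.ceil_lt_add_one (by positivity)
  have hb : ∀ j, c j ≤ (if j < J then 1 else 0) + j * c j / √n := by
    intro j
    have h0 := h.nonneg j
    split_ifs with hj
    · have : 0 ≤ j * c j / √n := by positivity
      linarith [h.le_one j]
    · have : √(n : ℝ) ≤ j := hJ1.trans (by exact_mod_cast not_lt.1 hj)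
      rw [zero_add, le_div_iff₀ (by linarith), mul_comm]
      exact mul_le_mul_of_nonneg_right this h0
  calc ∑ j ∈ range N, c j ≤ ∑ j ∈ range N, ((if j < J then (1 : ℝ) else 0) + j * c j / √n) :=
        sum_le_sum fun j _ => hb j
    _ = ∑ j ∈ range N, (if j < J then (1 : ℝ) else 0) + (∑ j ∈ range N, j * c j) / √n := by
        rw [sum_add_distrib, sum_div]
    _ ≤ J + n / √n := by
        gcongr
        · rw [← sum_filter, sum_const, nsmul_eq_mul, mul_one, Nat.cast_le]
          calc _ ≤ (range J).card := card_le_card fun x hx => by simp at hx ⊢; exact hx.2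
            _ = J := card_range J
        · exact h.moment N
    _ ≤ 3 * √n := by
        rw [show (n : ℝ) / √n = √n by rw [div_eq_iff (by positivity), hs2]]
        linarith

lemma summable (h : SlowDecay n c) (hn : 1 ≤ n) : Summable c :=
  summable_of_sum_range_le h.nonneg (h.sum_range_le hn)

lemma tsum_le (h : SlowDecay n c) (hn : 1 ≤ n) : ∑' j, c j ≤ 3 * √n :=
  Real.tsum_le_of_sum_range_le h.nonneg (h.sum_range_le hn)

lemma norm_term_le (h : SlowDecay n c) {u : ℂ} (hu : ‖u‖ ≤ 1) (j : ℕ) :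
    ‖(c j : ℂ) * u ^ j‖ ≤ c j := by
  rw [norm_mul, norm_pow, Complex.norm_real, Real.norm_of_nonneg (h.nonneg j)]
  exact mul_le_of_le_one_right (h.nonneg j) (pow_le_one₀ (norm_nonneg _) hu)

lemma summable_mul_pow (h : SlowDecay n c) (hn : 1 ≤ n) {u : ℂ} (hu : ‖u‖ ≤ 1) :
    Summable fun j => (c j : ℂ) * u ^ j :=
  Summable.of_norm_bounded (h.summable hn) (h.norm_term_le hu)

lemma norm_tsum_le (h : SlowDecay n c) (hn : 1 ≤ n) {u : ℂ} (hu : ‖u‖ ≤ 1) :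
    ‖∑' j, (c j : ℂ) * u ^ j‖ ≤ 3 * √n :=
  (tsum_of_norm_bounded (h.summable hn).hasSum (h.norm_term_le hu)).trans (h.tsum_le hn)

lemma weighted_diff_sum (c : ℕ → ℝ) (N : ℕ) :
    ∑ j ∈ range N, ((j : ℝ) + 1) * (c j - c (j + 1)) + N * c N = ∑ j ∈ range N, c j := by
  induction N with
  | zero => simp
  | succ N ih => rw [sum_range_succ, sum_range_succ, ← ih]; push_cast; ring

/-- The bound on second differences involves `b_j = c_j + (j+1)(c_j - c_(j+1))`. By Abel summation
both parts of `b` sum to at most `3√n`, so two copies of `b` divided by `n` give `12/√n`. -/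
lemma sum_second_diff_le (h : SlowDecay n c) (hn : 1 ≤ n) (N : ℕ) :
    ∑ j ∈ range N, |(c (j + 1) - c (j + 2)) - (c j - c (j + 1))| ≤ 12 / √n := by
  have hn' : (1 : ℝ) ≤ n := by exact_mod_cast hn
  have hs2 : √(n : ℝ) * √n = n := Real.mul_self_sqrt (by positivity)
  set b : ℕ → ℝ := fun j => c j + (j + 1) * (c j - c (j + 1)) with hb
  have hb0 : ∀ j, 0 ≤ b j := fun j => by
    have := h.nonneg j
    have := sub_nonneg.2 (h.anti j)
    positivity
  have hbs : ∀ N, ∑ j ∈ range N, b j ≤ 6 * √n := fun N => by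
    have h1 := h.sum_range_le hn N
    have h2 := weighted_diff_sum c N
    have h3 : 0 ≤ N * c N := mul_nonneg (by positivity) (h.nonneg N)
    rw [hb, sum_add_distrib]
    linarith
  calc _ ≤ ∑ j ∈ range N, (b j + b (j + 1)) / n := sum_le_sum fun j _ => by
        have := h.second_diff j
        simp only [hb]
        convert! this using 3
        push_cast; ring
    _ = (∑ j ∈ range N, b j + ∑ j ∈ range N, b (j + 1)) / n := by
        rw [← sum_div, sum_add_distrib]
    _ ≤ (6 * √n + 6 * √n) / n := by
        gcongr
        · exact hbs N
        · have := hbs (N + 1)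
          rw [sum_range_succ'] at this
          linarith [hb0 0]
    _ = 12 / √n := by
        rw [div_eq_div_iff (by positivity) (by positivity)]
        linear_combination 12 * hs2

/-- Two summations by parts leave the first difference at `0` plus the series of second differences,
over `(1 - u)^2`; these cost `1/√n` and `12/√n`. The bound is uniform up to the unit circle, away
from `u = 1`. -/
lemma norm_tsum_sub_le (h : SlowDecay n c) (hn : 1 ≤ n) {u : ℂ} (hu : ‖u‖ ≤ 1) (hu1 : u ≠ 1) :
    ‖∑' j, (c j : ℂ) * u ^ j - 1 / (1 - u)‖ ≤ 13 / (√n * ‖1 - u‖ ^ 2) := by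
  have hn' : (1 : ℝ) ≤ n := by exact_mod_cast hn
  have hs2 : √(n : ℝ) * √n = n := Real.mul_self_sqrt (by positivity)
  have hs : 1 ≤ √(n : ℝ) := Real.one_le_sqrt.2 hn'
  have hne : (1 - u) ≠ 0 := sub_ne_zero.2 hu1.symm
  have hpos : 0 < ‖1 - u‖ := norm_pos_iff.2 hne
  -- summation by parts
  have abel : ∀ {a : ℕ → ℝ}, Summable (fun j => (a j : ℂ) * u ^ j) →
      (1 - u) * ∑' j, (a j : ℂ) * u ^ j =
        a 0 + u * ∑' j, ((a (j + 1) - a j : ℝ) : ℂ) * u ^ j ∧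
      Summable (fun j => ((a (j + 1) - a j : ℝ) : ℂ) * u ^ j * u) := by
    intro a ha
    have h1 : Summable (fun j => (a (j + 1) : ℂ) * u ^ (j + 1)) :=
      (summable_nat_add_iff (f := fun j => (a j : ℂ) * u ^ j) 1).2 ha
    have h2 : Summable (fun j => (a j : ℂ) * u ^ j * u) := ha.mul_right u
    have h3 : ∀ j, ((a (j + 1) - a j : ℝ) : ℂ) * u ^ j * u =
        (a (j + 1) : ℂ) * u ^ (j + 1) - (a j : ℂ) * u ^ j * u := fun j => by push_cast; ring
    constructor
    · rw [sub_mul, one_mul, ha.tsum_eq_zero_add, mul_comm u (∑' j, _), ← tsum_mul_right,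
        tsum_congr h3, h1.tsum_sub h2, tsum_mul_right, ha.tsum_eq_zero_add]
      simp; ring
    · simpa only [h3] using h1.sub h2
  set δ : ℕ → ℝ := fun j => c (j + 1) - c j with hδ
  have hsδ : Summable (fun j => (δ j : ℂ) * u ^ j) := by
    refine Summable.of_norm_bounded (h.summable hn) fun j => ?_
    rw [norm_mul, norm_pow, Complex.norm_real, Real.norm_eq_abs, hδ]
    have h1 := h.anti j
    have h2 := h.nonneg (j + 1)
    rw [abs_of_nonpos (by simpa using h1)]
    exact (mul_le_of_le_one_right (by linarith) (pow_le_one₀ (norm_nonneg _) hu)).trans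
      (by linarith)
  obtain ⟨e1, -⟩ := abel (h.summable_mul_pow hn hu)
  obtain ⟨e2, -⟩ := abel hsδ
  have hdd : ∀ j, |δ (j + 1) - δ j| = |(c (j + 1) - c (j + 2)) - (c j - c (j + 1))| := fun j => by
    rw [← abs_neg]; simp only [hδ]; congr 1; ring
  have hsum : Summable fun j => |δ (j + 1) - δ j| :=
    summable_of_sum_range_le (c := 12 / √n) (fun j => abs_nonneg _) fun N => by
      simpa only [hdd] using h.sum_second_diff_le hn N
  have hle : ∑' j, |δ (j + 1) - δ j| ≤ 12 / √n :=
    Real.tsum_le_of_sum_range_le (fun j => abs_nonneg _) fun N => by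
      simpa only [hdd] using h.sum_second_diff_le hn N
  have h3 : ‖∑' j, ((δ (j + 1) - δ j : ℝ) : ℂ) * u ^ j‖ ≤ 12 / √n := by
    refine (tsum_of_norm_bounded hsum.hasSum fun j => ?_).trans hle
    rw [norm_mul, norm_pow, Complex.norm_real, Real.norm_eq_abs]
    exact mul_le_of_le_one_right (abs_nonneg _) (pow_le_one₀ (norm_nonneg _) hu)
  have h4 : ‖(δ 0 : ℂ)‖ ≤ 1 / √n := by
    rw [Complex.norm_real, Real.norm_eq_abs, hδ]
    have h1 := h.anti 0
    have h5 := h.diff_zero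
    rw [abs_of_nonpos (by simpa using h1)]
    have : 1 / (n : ℝ) ≤ 1 / √n := by
      apply one_div_le_one_div_of_le (by linarith)
      nlinarith
    simp only [zero_add] at *
    linarith
  have h5 : ‖(1 - u) * ∑' j, (δ j : ℂ) * u ^ j‖ ≤ 13 / √n := by
    rw [e2]
    calc _ ≤ 1 / √n + 1 * (12 / √n) := (norm_add_le _ _).trans (add_le_add h4 (by
          rw [norm_mul]; gcongr))
      _ = 13 / √n := by ring
  have key : ∑' j, (c j : ℂ) * u ^ j - 1 / (1 - u) =
      u * ((1 - u) * ∑' j, (δ j : ℂ) * u ^ j) / (1 - u) ^ 2 := by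
    have : ∑' j, (c j : ℂ) * u ^ j = (1 + u * ∑' j, (δ j : ℂ) * u ^ j) / (1 - u) := by
      rw [eq_div_iff hne, mul_comm, e1, h.zero, Complex.ofReal_one]
    rw [this]
    field_simp
    ring
  rw [key, norm_div, norm_mul, norm_pow]
  calc _ ≤ 1 * (13 / √n) / ‖1 - u‖ ^ 2 := by gcongr
    _ = _ := by rw [one_mul, div_div]

end SlowDecay

/-! ### Factorial ratios on either side of the top term -/

/-- The ratio `n (n-1) ⋯ (n-k+1) / n ^ k`. -/
noncomputable def fallRatio (n k : ℕ) : ℝ := ∏ i ∈ range k, (1 - (i : ℝ) / n)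

/-- The ratio `n ^ j / ((n+1) (n+2) ⋯ (n+j))`. -/
noncomputable def riseRatio (n j : ℕ) : ℝ := ∏ i ∈ range j, ((n : ℝ) / (n + 1 + i))

lemma fallRatio_succ (n k : ℕ) : fallRatio n (k + 1) = fallRatio n k * (1 - (k : ℝ) / n) :=
  prod_range_succ _ _

lemma riseRatio_succ (n k : ℕ) : riseRatio n (k + 1) = riseRatio n k * ((n : ℝ) / (n + 1 + k)) :=
  prod_range_succ _ _

lemma fallRatio_eq_zero {n k : ℕ} (hn : 1 ≤ n) (hk : n < k) : fallRatio n k = 0 :=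
  prod_eq_zero (mem_range.2 hk) (by
    have : (n : ℝ) ≠ 0 := by positivity
    simp [this])

lemma fallRatio_nonneg (n k : ℕ) (hn : 1 ≤ n) : 0 ≤ fallRatio n k := by
  rcases lt_or_ge n k with hk | hk
  · exact (fallRatio_eq_zero hn hk).ge
  · refine prod_nonneg fun i hi => sub_nonneg.2 (div_le_one_of_le₀ ?_ (by positivity))
    exact_mod_cast (mem_range.1 hi).le.trans hk

lemma fallRatio_diff (n k : ℕ) :
    fallRatio n k - fallRatio n (k + 1) = k * fallRatio n k / n := by
  rw [fallRatio_succ]; ring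

lemma riseRatio_nonneg (n k : ℕ) : 0 ≤ riseRatio n k :=
  prod_nonneg fun i _ => by positivity

lemma riseRatio_diff (n k : ℕ) (hn : 1 ≤ n) :
    riseRatio n k - riseRatio n (k + 1) = (k + 1) * riseRatio n (k + 1) / n := by
  have : (n : ℝ) ≠ 0 := by positivity
  rw [riseRatio_succ]
  field_simp
  ring

lemma slowDecay_fallRatio {n : ℕ} (hn : 1 ≤ n) : SlowDecay n (fallRatio n) := by
  have hn0 : (0 : ℝ) < n := by exact_mod_cast hn
  have hnn := fun k => fallRatio_nonneg n k hn
  have hanti : ∀ k, fallRatio n (k + 1) ≤ fallRatio n k := fun k => by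
    have h1 := fallRatio_diff n k
    have h2 : 0 ≤ k * fallRatio n k / n := by have := hnn k; positivity
    linarith
  refine ⟨by simp [fallRatio], hnn, hanti, fun N => ?_, ?_, fun k => ?_⟩
  -- `j c_j` is `n` times a difference of `c`, so the moment sum telescopes to `n (1 - c_N)`.
  · have : ∀ j : ℕ, (j : ℝ) * fallRatio n j = n * (fallRatio n j - fallRatio n (j + 1)) := fun j => by
      rw [fallRatio_diff]; field_simp
    simp only [this]
    rw [← mul_sum, sum_range_sub']
    have h0 : fallRatio n 0 = 1 := by simp [fallRatio]
    nlinarith [hnn N]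
  · simp [fallRatio]
  · have h1 := fallRatio_diff n k
    have h2 := fallRatio_diff n (k + 1)
    have h3 : (fallRatio n (k + 1) - fallRatio n (k + 2)) - (fallRatio n k - fallRatio n (k + 1))
        = (fallRatio n (k + 1) - k * (fallRatio n k - fallRatio n (k + 1))) / n := by
      push_cast at h2
      linear_combination h2 - h1
    rw [h3, abs_div, abs_of_pos hn0]
    have d1 := sub_nonneg.2 (hanti k)
    have d2 := sub_nonneg.2 (hanti (k + 1))
    have p1 : 0 ≤ (k : ℝ) * (fallRatio n k - fallRatio n (k + 1)) := by positivity
    have p2 : 0 ≤ ((k : ℝ) + 2) * (fallRatio n (k + 1) - fallRatio n (k + 1 + 1)) := by positivity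
    gcongr
    have := hnn k
    have := hnn (k + 1)
    rw [abs_le]
    constructor <;> nlinarith

lemma slowDecay_riseRatio {n : ℕ} (hn : 1 ≤ n) : SlowDecay n (riseRatio n) := by
  have hn0 : (0 : ℝ) < n := by exact_mod_cast hn
  have hnn := fun k => riseRatio_nonneg n k
  have hdiff := fun k => riseRatio_diff n k hn
  have hanti : ∀ k, riseRatio n (k + 1) ≤ riseRatio n k := fun k => by
    have h1 := hdiff k
    have h2 : 0 ≤ (k + 1) * riseRatio n (k + 1) / n := by have := hnn (k + 1); positivity
    linarith
  have h0 : riseRatio n 0 = 1 := by simp [riseRatio]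
  refine ⟨h0, hnn, hanti, fun N => ?_, ?_, fun k => ?_⟩
  · rcases N with _ | N
    · simp
    have : ∀ j : ℕ, ((j + 1 : ℕ) : ℝ) * riseRatio n (j + 1) =
        n * (riseRatio n j - riseRatio n (j + 1)) := fun j => by
      rw [hdiff]; push_cast; field_simp
    rw [sum_range_succ']
    simp only [this]
    rw [← mul_sum, sum_range_sub']
    push_cast
    nlinarith [hnn N]
  · rw [hdiff 0]
    have := (hanti 0).trans h0.le
    gcongr
    simpa using this
  · have h1 := hdiff k
    have h2 := hdiff (k + 1)
    have h3 : (riseRatio n (k + 1) - riseRatio n (k + 2)) - (riseRatio n k - riseRatio n (k + 1))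
        = (riseRatio n (k + 1) - (k + 2) * (riseRatio n (k + 1) - riseRatio n (k + 2))) / n := by
      rw [h1]
      field_simp
      have h2' : (n : ℝ) * (riseRatio n (k + 1) - riseRatio n (k + 2)) =
          (k + 2) * riseRatio n (k + 2) := by
        rw [h2]; push_cast; field_simp; ring
      linear_combination h2'
    rw [h3, abs_div, abs_of_pos hn0]
    have d1 := sub_nonneg.2 (hanti k)
    have d2 := sub_nonneg.2 (hanti (k + 1))
    have p1 : 0 ≤ ((k : ℝ) + 1) * (riseRatio n k - riseRatio n (k + 1)) := by positivity
    have p2 : 0 ≤ ((k : ℝ) + 2) * (riseRatio n (k + 1) - riseRatio n (k + 1 + 1)) := by positivity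
    gcongr
    have := hnn k
    have := hnn (k + 1)
    rw [abs_le]
    constructor <;> nlinarith

/-- Sum of the consecutive differences `i c_i / n ≤ i / n` over `i < k`. It allows `fallRatio` to be
replaced by `1` against geometrically decaying coefficients. -/
lemma one_sub_fallRatio_le {n : ℕ} (hn : 1 ≤ n) (k : ℕ) : 1 - fallRatio n k ≤ (k : ℝ) ^ 2 / n := by
  have hn0 : (0 : ℝ) < n := by exact_mod_cast hn
  induction k with
  | zero => simp [fallRatio]
  | succ k ih =>
    have h1 := fallRatio_diff n k
    have h2 : k * fallRatio n k / n ≤ k * 1 / n := by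
      gcongr
      exact (slowDecay_fallRatio hn).le_one k
    have h3 : ((k + 1 : ℕ) : ℝ) ^ 2 / n = (k : ℝ) ^ 2 / n + k * 1 / n + (k + 1) / n := by
      push_cast; ring
    have : 0 ≤ ((k : ℝ) + 1) / n := by positivity
    linarith

/-! ### Asymptotics of the truncated exponential -/

/-- The Taylor polynomial of degree `n` of the exponential function. -/
noncomputable def expTrunc (n : ℕ) (x : ℂ) : ℂ := ∑ k ∈ range (n + 1), x ^ k / (k.factorial : ℂ)

/-- The top term `(n σ) ^ n / n!` of the rescaled truncated exponential. -/
noncomputable def topTerm (n : ℕ) (σ : ℂ) : ℂ := (n * σ) ^ n / (n.factorial : ℂ)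

lemma pow_div_factorial_add (n j : ℕ) :
    (n : ℝ) ^ (n + j) / ((n + j).factorial : ℝ) = n ^ n / (n.factorial : ℝ) * riseRatio n j := by
  induction j with
  | zero => simp [riseRatio]
  | succ j ih =>
    rw [riseRatio_succ, ← mul_assoc, ← ih, ← add_assoc, Nat.factorial_succ, pow_succ]
    push_cast
    rw [div_mul_div_comm, add_right_comm (n : ℝ) 1]
    ring

lemma pow_div_factorial_sub {n k : ℕ} (hn : 1 ≤ n) (hk : k ≤ n) :
    (n : ℝ) ^ (n - k) / ((n - k).factorial : ℝ) = n ^ n / (n.factorial : ℝ) * fallRatio n k := by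
  have hn0 : (n : ℝ) ≠ 0 := by positivity
  induction k with
  | zero => simp [fallRatio]
  | succ k ih =>
    obtain ⟨m, rfl⟩ : ∃ m, n = k + 1 + m := ⟨n - (k + 1), by omega⟩
    rw [fallRatio_succ, ← mul_assoc, ← ih (by omega),
      show k + 1 + m - k = m + 1 by omega, show k + 1 + m - (k + 1) = m by omega,
      Nat.factorial_succ, pow_succ]
    have : ((m : ℝ) + 1) ≠ 0 := by positivity
    push_cast at *
    field_simp
    ring

/-- Read the Taylor polynomial from its top term downwards; the series may be written as infinite
because `fallRatio n k` vanishes for `k > n`. -/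
lemma expTrunc_eq {n : ℕ} (hn : 1 ≤ n) {σ : ℂ} (hσ : σ ≠ 0) :
    expTrunc n (n * σ) = topTerm n σ * ∑' k, (fallRatio n k : ℂ) * σ⁻¹ ^ k := by
  rw [tsum_eq_sum (s := range (n + 1)) fun k hk => by
    rw [fallRatio_eq_zero hn (by simpa [Nat.lt_succ_iff] using hk)]; simp]
  rw [expTrunc, ← sum_range_reflect, mul_sum]
  refine sum_congr rfl fun k hk => ?_
  have hk : k ≤ n := by simpa [Nat.lt_succ_iff] using hk
  rw [show n + 1 - 1 - k = n - k by omega, topTerm]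
  have h : (n : ℂ) ^ (n - k) / ((n - k).factorial : ℂ) =
      n ^ n / (n.factorial : ℂ) * fallRatio n k := by
    simpa using congrArg Complex.ofReal (pow_div_factorial_sub hn hk)
  rw [mul_pow, mul_pow, mul_div_right_comm, h, ← Nat.sub_add_cancel hk]
  simp only [Nat.add_sub_cancel, pow_add, inv_pow]
  field_simp

/-- The tail of the exponential series, read upwards from degree `n`. The `-1` removes the term `j =
0`, which belongs to the truncation. -/
lemma exp_sub_expTrunc {n : ℕ} (hn : 1 ≤ n) {σ : ℂ} (hσ : ‖σ‖ ≤ 1) :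
    Complex.exp (n * σ) - expTrunc n (n * σ) =
      topTerm n σ * (∑' j, (riseRatio n j : ℂ) * σ ^ j - 1) := by
  have hS := NormedSpace.expSeries_div_hasSum_exp (n * σ : ℂ)
  rw [← Complex.exp_eq_exp_ℂ] at hS
  have hs := (slowDecay_riseRatio hn).summable_mul_pow hn hσ
  rw [← hS.tsum_eq, expTrunc, ← hS.summable.sum_add_tsum_nat_add (n + 1), add_sub_cancel_left,
    hs.tsum_eq_zero_add]
  simp only [riseRatio, range_zero, prod_empty, Complex.ofReal_one, pow_zero, mul_one,
    add_sub_cancel_left]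
  rw [← tsum_mul_left]
  refine tsum_congr fun j => ?_
  have h : (n : ℂ) ^ (n + (j + 1)) / ((n + (j + 1)).factorial : ℂ) =
      n ^ n / (n.factorial : ℂ) * riseRatio n (j + 1) := by
    simpa using congrArg Complex.ofReal (pow_div_factorial_add n (j + 1))
  change _ = _ * ((riseRatio n (j + 1) : ℂ) * _)
  rw [show j + (n + 1) = n + (j + 1) by ring, mul_pow, mul_div_right_comm, h, topTerm, mul_pow,
    pow_add]
  ring

lemma norm_expTrunc_sub_exp_le {n : ℕ} (hn : 1 ≤ n) {σ : ℂ} (hσ : ‖σ‖ ≤ 1) :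
    ‖expTrunc n (n * σ) - Complex.exp (n * σ)‖ ≤ 4 * √n * ‖topTerm n σ‖ := by
  have hs : 1 ≤ √(n : ℝ) := Real.one_le_sqrt.2 (by exact_mod_cast hn)
  rw [norm_sub_rev, exp_sub_expTrunc hn hσ, norm_mul, mul_comm]
  gcongr
  have := (slowDecay_riseRatio hn).norm_tsum_le hn hσ
  have h2 := norm_sub_le (∑' j, (riseRatio n j : ℂ) * σ ^ j) 1
  rw [norm_one] at h2
  linarith

lemma norm_expTrunc_le {n : ℕ} (hn : 1 ≤ n) {σ : ℂ} (hσ : 1 ≤ ‖σ‖) :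
    ‖expTrunc n (n * σ)‖ ≤ 4 * √n * ‖topTerm n σ‖ := by
  have hs : 1 ≤ √(n : ℝ) := Real.one_le_sqrt.2 (by exact_mod_cast hn)
  have h0 : σ ≠ 0 := norm_pos_iff.1 (by linarith)
  rw [expTrunc_eq hn h0, norm_mul, mul_comm]
  gcongr
  have := (slowDecay_fallRatio hn).norm_tsum_le hn (u := σ⁻¹)
    (by rw [norm_inv]; exact inv_le_one_of_one_le₀ hσ)
  linarith

/-- Since `1/(1 - σ⁻¹) = 1 - 1/(1 - σ)`, the tail expansion inside the disc has the same main term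
`topTerm/(1 - σ⁻¹)` as the expansion outside it. -/
lemma norm_expTrunc_sub_le_of_le {n : ℕ} (hn : 1 ≤ n) {σ : ℂ} (hσ : ‖σ‖ ≤ 1) (h1 : σ ≠ 1)
    (h0 : σ ≠ 0) :
    ‖expTrunc n (n * σ) - Complex.exp (n * σ) - topTerm n σ * (1 / (1 - σ⁻¹))‖ ≤
      13 / (√n * ‖1 - σ‖ ^ 2) * ‖topTerm n σ‖ := by
  have h2 : (1 - σ) ≠ 0 := sub_ne_zero.2 h1.symm
  have h3 : (σ - 1) ≠ 0 := sub_ne_zero.2 h1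
  have key : expTrunc n (n * σ) - Complex.exp (n * σ) - topTerm n σ * (1 / (1 - σ⁻¹)) =
      -(topTerm n σ * (∑' j, (riseRatio n j : ℂ) * σ ^ j - 1 / (1 - σ))) := by
    have h4 : 1 / (1 - σ⁻¹) = 1 - 1 / (1 - σ) := by
      rw [show 1 - σ⁻¹ = (σ - 1) / σ by field_simp]
      rw [← neg_sub σ 1]
      field_simp
      ring
    rw [h4]
    linear_combination -(exp_sub_expTrunc hn hσ)
  rw [key, norm_neg, norm_mul, mul_comm]
  gcongr
  exact (slowDecay_riseRatio hn).norm_tsum_sub_le hn hσ h1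

lemma norm_expTrunc_sub_le_of_ge {n : ℕ} (hn : 1 ≤ n) {σ : ℂ} (hσ : 1 ≤ ‖σ‖) (h1 : σ ≠ 1) :
    ‖expTrunc n (n * σ) - topTerm n σ * (1 / (1 - σ⁻¹))‖ ≤
      13 / (√n * ‖1 - σ⁻¹‖ ^ 2) * ‖topTerm n σ‖ := by
  have h0 : σ ≠ 0 := norm_pos_iff.1 (by linarith)
  rw [expTrunc_eq hn h0, ← mul_sub, norm_mul, mul_comm]
  gcongr
  exact (slowDecay_fallRatio hn).norm_tsum_sub_le hn
    (by rw [norm_inv]; exact inv_le_one_of_one_le₀ hσ) (by simpa using h1)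

lemma topTerm_mul (n : ℕ) (a σ : ℂ) : topTerm n (a * σ) = a ^ n * topTerm n σ := by
  rw [topTerm, topTerm, mul_left_comm, mul_pow, mul_div_assoc]

lemma norm_topTerm (n : ℕ) (σ : ℂ) :
    ‖topTerm n σ‖ = (n : ℝ) ^ n / (n.factorial : ℝ) * ‖σ‖ ^ n := by
  simp [topTerm, mul_pow]; ring

lemma pow_self_div_factorial_le (n : ℕ) : (n : ℝ) ^ n / (n.factorial : ℝ) ≤ Real.exp 1 ^ n := by
  rw [← Real.exp_nat_mul, mul_one]
  exact Real.pow_div_factorial_le_exp _ (by positivity) n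

/-- A weak Stirling bound. At `σ = 1` the inner and the outer estimate both apply, so `e^n` is at
most the truncation error plus the truncation, each `4√n` times the top term. -/
lemma exp_pow_le {n : ℕ} (hn : 1 ≤ n) :
    Real.exp 1 ^ n ≤ 8 * √n * ((n : ℝ) ^ n / (n.factorial : ℝ)) := by
  have h1 := norm_expTrunc_sub_exp_le hn (σ := 1) (by simp)
  have h2 := norm_expTrunc_le hn (σ := 1) (by simp)
  have h3 := norm_topTerm n 1
  have h4 : ‖Complex.exp (n * 1)‖ = Real.exp 1 ^ n := by
    rw [Complex.norm_exp, ← Real.exp_nat_mul]; simp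
  rw [norm_one, one_pow, mul_one] at h3
  rw [h3] at h1 h2
  rw [← h4]
  calc _ ≤ ‖expTrunc n (n * 1) - Complex.exp (n * 1)‖ + ‖expTrunc n (n * 1)‖ := by
        rw [norm_sub_rev]
        simpa using norm_add_le (Complex.exp (n * 1) - expTrunc n (n * 1)) (expTrunc n (n * 1))
    _ ≤ _ := by linarith

lemma norm_topTerm_le (n : ℕ) (σ : ℂ) : ‖topTerm n σ‖ ≤ (Real.exp 1 * ‖σ‖) ^ n := by
  rw [norm_topTerm, mul_pow]
  gcongr
  exact pow_self_div_factorial_le n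

lemma le_norm_topTerm {n : ℕ} (hn : 1 ≤ n) (σ : ℂ) :
    (Real.exp 1 * ‖σ‖) ^ n ≤ 8 * √n * ‖topTerm n σ‖ := by
  rw [norm_topTerm, mul_pow, ← mul_assoc]
  gcongr
  exact exp_pow_le hn

/-! ### The generating function and its poles -/

/-- The Taylor coefficients of `t / (exp t - 1)` in the variable `v` with `t = -2 π i v`. -/
noncomputable def bernCoeff (k : ℕ) : ℂ :=
  (-2 * Real.pi * Complex.I) ^ k * (bernoulli k : ℂ) / (k.factorial : ℂ)

/-- The coefficients left after removing the four poles of smallest modulus. -/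
noncomputable def remCoeff (k : ℕ) : ℂ :=
  bernCoeff k + 1 + (-1) ^ k + (1 / 2) ^ k + (-1 / 2) ^ k

lemma remCoeff_zero : remCoeff 0 = 5 := by
  simp [remCoeff, bernCoeff]; norm_num

lemma remCoeff_one : remCoeff 1 = Real.pi * Complex.I := by
  simp [remCoeff, bernCoeff]; ring

lemma remCoeff_odd (j : ℕ) : remCoeff (2 * (j + 1) + 1) = 0 := by
  have h : bernoulli (2 * (j + 1) + 1) = 0 :=
    bernoulli_eq_zero_of_odd ⟨_, rfl⟩ (by omega)
  have h2 : Odd (2 * (j + 1) + 1) := ⟨_, rfl⟩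
  rw [remCoeff, bernCoeff, h, neg_div, h2.neg_pow, h2.neg_pow]
  simp

lemma hasSum_bernCoeff (j : ℕ) :
    HasSum (fun m : ℕ => (-2 / (m : ℂ) ^ (2 * (j + 1)))) (bernCoeff (2 * (j + 1))) := by
  have h := ((Complex.hasSum_ofReal.2 (hasSum_zeta_nat (k := j + 1) (by omega)))).mul_left (-2)
  convert! h using 1
  · ext m; push_cast; ring
  · rw [bernCoeff, pow_mul, show (-2 * (Real.pi : ℂ) * Complex.I) ^ 2 = (-1) * (2 * Real.pi) ^ 2 by
      rw [mul_pow, Complex.I_sq]; ring, mul_pow, ← pow_mul, mul_pow]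
    push_cast
    rw [show 2 * (j + 1) = 2 * (j + 1) - 1 + 1 by omega, pow_succ (2 : ℂ)]
    simp only [Nat.add_sub_cancel]
    ring

lemma hasSum_remCoeff (j : ℕ) :
    HasSum (fun m : ℕ => (-2 / ((m : ℂ) + 3) ^ (2 * (j + 1)))) (remCoeff (2 * (j + 1))) := by
  -- The three dropped terms are `m = 1` and `m = 2`, the removed poles, and `m = 0`, which is `-2 /
  -- 0 = 0`.
  have h := (hasSum_nat_add_iff' 3).2 (hasSum_bernCoeff j)
  have h2 : Even (2 * (j + 1)) := even_two_mul _
  convert! h using 1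
  · ext m; push_cast; rfl
  · rw [remCoeff, neg_div, h2.neg_pow, h2.neg_pow]
    simp [sum_range_succ]
    ring

lemma norm_natCast_add_three (m : ℕ) : ‖(m : ℂ) + 3‖ = (m : ℝ) + 3 := by
  rw [show (m : ℂ) + 3 = ((m : ℝ) + 3 : ℝ) by push_cast; rfl, Complex.norm_real,
    Real.norm_of_nonneg (by positivity)]

/-- The nearest remaining poles are `±3`. In the constant, `S` covers the even `k ≥ 2`, `5` covers
`k = 0`, and `3π` covers `k = 1`; the other odd coefficients vanish. -/
lemma exists_remCoeff_bound : ∃ C : ℝ, 0 < C ∧ ∀ k, ‖remCoeff k‖ ≤ C * (1 / 3) ^ k := by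
  have hs : Summable fun m : ℕ => 2 * (3 / ((m : ℝ) + 3)) ^ 2 := by
    have h := (summable_nat_add_iff 3).2 (Real.summable_one_div_nat_pow.2 (le_refl 2))
    refine (h.mul_left 18).congr fun m => ?_
    push_cast
    field_simp
    norm_num
  set S := ∑' m : ℕ, 2 * (3 / ((m : ℝ) + 3)) ^ 2 with hS
  have hS0 : 0 ≤ S := tsum_nonneg fun m => by positivity
  have hpi := Real.pi_pos
  have hC : 0 ≤ S + 5 + 3 * Real.pi := by linarith
  refine ⟨S + 5 + 3 * Real.pi, by linarith, fun k => ?_⟩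
  obtain ⟨j, rfl | rfl⟩ := Nat.even_or_odd' k
  · rcases j with _ | j
    · simp only [mul_zero, remCoeff_zero, pow_zero, mul_one, RCLike.norm_ofNat]
      linarith
    · rw [← (hasSum_remCoeff j).tsum_eq]
      calc _ ≤ S * (1 / 3) ^ (2 * (j + 1)) := by
            refine tsum_of_norm_bounded (hs.hasSum.mul_right _) fun m => ?_
            rw [norm_div, norm_pow, norm_neg, norm_natCast_add_three, RCLike.norm_ofNat]
            have h5 : (3 / ((m : ℝ) + 3)) ^ (2 * (j + 1)) ≤ (3 / ((m : ℝ) + 3)) ^ 2 :=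
              pow_le_pow_of_le_one (by positivity)
                (div_le_one_of_le₀ (by linarith [(m.cast_nonneg : (0 : ℝ) ≤ m)]) (by positivity))
                (by omega)
            calc (2 : ℝ) / ((m : ℝ) + 3) ^ (2 * (j + 1))
                = 2 * (3 / ((m : ℝ) + 3)) ^ (2 * (j + 1)) * (1 / 3) ^ (2 * (j + 1)) := by
                  rw [mul_assoc, ← mul_pow, div_mul_div_comm, mul_one, mul_comm (_ + _),
                    ← div_div, div_self three_ne_zero, div_pow, one_pow]
                  ring
              _ ≤ _ := by gcongr
        _ ≤ _ := by gcongr; linarith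
  · rcases j with _ | j
    · simp [remCoeff_one, abs_of_pos hpi]; linarith
    · rw [remCoeff_odd, norm_zero]; positivity

lemma summable_remCoeff {v : ℂ} (hv : ‖v‖ < 3) : Summable fun k => remCoeff k * v ^ k := by
  obtain ⟨C, hC, h⟩ := exists_remCoeff_bound
  refine Summable.of_norm_bounded
    ((summable_geometric_of_lt_one (r := ‖v‖ / 3) (by positivity) (by linarith)).mul_left C)
    fun k => ?_
  rw [norm_mul, norm_pow]
  calc _ ≤ C * (1 / 3) ^ k * ‖v‖ ^ k := by gcongr; exact h k
    _ = _ := by rw [mul_assoc, ← mul_pow]; congr 2; ring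

/-- The function `t / (exp t - 1)` in the variable `v` with `t = -2 π i v`, written with its
first four poles split off. -/
noncomputable def bernGen (v : ℂ) : ℂ :=
  ∑' k, remCoeff k * v ^ k - 1 / (1 - v) - 1 / (1 + v) - 1 / (1 - v / 2) - 1 / (1 + v / 2)

lemma cotTerm_eq_tsum {v w : ℂ} (hv : ‖v‖ < ‖w‖) :
    v * (1 / (v - w) + 1 / (v + w)) = ∑' j : ℕ, -2 * (v / w) ^ (2 * (j + 1)) := by
  have hw : 0 < ‖w‖ := (norm_nonneg v).trans_lt hv
  have hw0 : w ≠ 0 := norm_pos_iff.1 hw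
  have hx : ‖(v / w) ^ 2‖ < 1 := by
    rw [norm_pow, norm_div]
    exact pow_lt_one₀ (by positivity) ((div_lt_one hw).2 hv) two_ne_zero
  have e : ∀ j : ℕ, -2 * (v / w) ^ (2 * (j + 1)) = -2 * (v / w) ^ 2 * ((v / w) ^ 2) ^ j :=
    fun j => by rw [← pow_mul]; ring
  simp only [e]
  rw [tsum_mul_left, tsum_geometric_of_norm_lt_one hx]
  have a1 : v - w ≠ 0 := fun h => by
    rw [sub_eq_zero.1 h] at hv; exact lt_irrefl _ hv
  have a2 : v + w ≠ 0 := fun h => by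
    rw [eq_neg_of_add_eq_zero_left h, norm_neg] at hv; exact lt_irrefl _ hv
  have a3 : w ^ 2 - v ^ 2 ≠ 0 := by
    rw [show w ^ 2 - v ^ 2 = -((v - w) * (v + w)) by ring]
    exact neg_ne_zero.2 (mul_ne_zero a1 a2)
  rw [show 1 - (v / w) ^ 2 = (w ^ 2 - v ^ 2) / w ^ 2 by field_simp]
  field_simp
  ring

lemma summable_cotTerm_expansion {v : ℂ} (hv : ‖v‖ < 3) :
    Summable (Function.uncurry fun (j m : ℕ) => -2 * (v / ((m : ℂ) + 3)) ^ (2 * (j + 1))) := by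
  have hr : Summable fun j : ℕ => ((‖v‖ / 3) ^ 2) ^ j :=
    summable_geometric_of_lt_one (by positivity)
      (pow_lt_one₀ (by positivity) (by linarith) two_ne_zero)
  have hz : Summable fun m : ℕ => 2 * (‖v‖ / ((m : ℝ) + 3)) ^ 2 := by
    have h := (summable_nat_add_iff 3).2 (Real.summable_one_div_nat_pow.2 (le_refl 2))
    refine (h.mul_left (2 * ‖v‖ ^ 2)).congr fun m => ?_
    push_cast
    rw [div_pow]
    ring
  refine Summable.of_norm_bounded (hr.mul_of_nonneg hz (fun _ => by positivity)
    fun _ => by positivity) fun ⟨j, m⟩ => ?_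
  rw [Function.uncurry_apply_pair, norm_mul, norm_pow, norm_div, norm_neg,
    norm_natCast_add_three, RCLike.norm_ofNat]
  calc 2 * (‖v‖ / ((m : ℝ) + 3)) ^ (2 * (j + 1))
      = ((‖v‖ / ((m : ℝ) + 3)) ^ 2) ^ j * (2 * (‖v‖ / ((m : ℝ) + 3)) ^ 2) := by
        rw [← pow_mul]; ring
    _ ≤ _ := by
        have : ‖v‖ / ((m : ℝ) + 3) ≤ ‖v‖ / 3 := by
          gcongr
          linarith [(m.cast_nonneg : (0 : ℝ) ≤ m)]
        dsimp only
        gcongr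

/-- The even coefficients are sums over the poles `m + 3`. Interchanging the two sums, absolutely
convergent for `‖v‖ < 3`, gives partial fractions; `5` and `πiv` are the exceptional terms `k = 0,
1`. -/
lemma tsum_remCoeff {v : ℂ} (hv : ‖v‖ < 3) :
    ∑' k, remCoeff k * v ^ k = 5 + Real.pi * Complex.I * v +
      ∑' m : ℕ, v * (1 / (v - (m + 3)) + 1 / (v + (m + 3))) := by
  have hs := summable_remCoeff hv
  have he : Summable fun j => remCoeff (2 * j) * v ^ (2 * j) :=
    hs.comp_injective (i := fun j => 2 * j) fun a b h => by simpa using h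
  have ho : Summable fun j => remCoeff (2 * j + 1) * v ^ (2 * j + 1) :=
    hs.comp_injective (i := fun j => 2 * j + 1) fun a b h => by simpa using h
  have h1 : ∀ j, remCoeff (2 * (j + 1)) * v ^ (2 * (j + 1)) =
      ∑' m : ℕ, -2 * (v / (m + 3)) ^ (2 * (j + 1)) := fun j => by
    rw [← (hasSum_remCoeff j).tsum_eq, ← tsum_mul_right]
    refine tsum_congr fun m => ?_
    rw [div_pow]; ring
  have h2 : ∀ m : ℕ, v * (1 / (v - (m + 3)) + 1 / (v + (m + 3))) =
      ∑' j : ℕ, -2 * (v / (m + 3)) ^ (2 * (j + 1)) := fun m => cotTerm_eq_tsum (by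
    rw [norm_natCast_add_three]; linarith [(m.cast_nonneg : (0 : ℝ) ≤ m)])
  have h3 : ∑' j, remCoeff (2 * (j + 1) + 1) * v ^ (2 * (j + 1) + 1) = 0 := by
    simp only [remCoeff_odd, zero_mul, tsum_zero]
  rw [← tsum_even_add_odd (f := fun k => remCoeff k * v ^ k) he ho, he.tsum_eq_zero_add, ho.tsum_eq_zero_add, h3, tsum_congr h1,
    tsum_congr h2, Summable.tsum_comm (summable_cotTerm_expansion hv)]
  simp only [mul_zero, remCoeff_zero, zero_add, remCoeff_one, pow_zero, pow_one, mul_one, add_zero]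
  ring

/-- Identifies `bernGen v` with `t/(e^t - 1)`. The Mittag-Leffler expansion of the cotangent yields
`πv cot(πv) + πiv`, which is this quotient written in exponentials. -/
lemma bernGen_mul {v : ℂ} (hv : ‖v‖ < 3) (h0 : v ≠ 0) (h1 : v ≠ 1) (h1' : v ≠ -1) (h2 : v ≠ 2)
    (h2' : v ≠ -2) :
    bernGen v * (Complex.exp (-2 * Real.pi * Complex.I * v) - 1) =
      -2 * Real.pi * Complex.I * v := by
  have hmem : v ∈ Complex.integerComplement := by
    rintro ⟨k, rfl⟩
    rw [Complex.norm_intCast] at hv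
    have : |k| < 3 := by exact_mod_cast hv
    rw [abs_lt] at this
    obtain ⟨ha, hb⟩ := this
    interval_cases k <;> simp_all
  have hcot := cot_series_rep' hmem
  have hsum := summable_cotTerm hmem
  have hsplit := hsum.sum_add_tsum_nat_add 2
  have hfull : Real.pi * v * Complex.cot (Real.pi * v) =
      1 + v * (1 / (v - 1) + 1 / (v + 1)) + v * (1 / (v - 2) + 1 / (v + 2)) +
      ∑' m : ℕ, v * (1 / (v - (m + 3)) + 1 / (v + (m + 3))) := by
    have e : (Real.pi : ℂ) * v * Complex.cot (Real.pi * v) =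
        v * (Real.pi * Complex.cot (Real.pi * v) - 1 / v) + 1 := by field_simp; ring
    rw [e, hcot, tsum_mul_left]
    simp only [cotTerm] at hsplit
    rw [← hsplit]
    simp only [sum_range_succ, sum_range_zero]
    push_cast
    ring_nf
  have p1 : (1 - v) ≠ 0 := sub_ne_zero.2 h1.symm
  have p2 : (1 + v) ≠ 0 := fun h => h1' (by linear_combination h)
  have p3 : (2 - v) ≠ 0 := sub_ne_zero.2 h2.symm
  have p4 : (2 + v) ≠ 0 := fun h => h2' (by linear_combination h)
  have hgen : bernGen v = Real.pi * v * Complex.cot (Real.pi * v) + Real.pi * Complex.I * v := by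
    rw [bernGen, tsum_remCoeff hv, hfull, show 1 - v / 2 = (2 - v) / 2 by ring,
      show 1 + v / 2 = (2 + v) / 2 by ring, show v - 1 = -(1 - v) by ring,
      show v - 2 = -(2 - v) by ring, add_comm v 1, add_comm v 2]
    field_simp
    ring
  rw [hgen, Complex.cot_pi_eq_exp_ratio]
  set E := Complex.exp (2 * Real.pi * Complex.I * v) with hE
  have hE0 : E ≠ 0 := Complex.exp_ne_zero _
  have hinv : Complex.exp (-2 * Real.pi * Complex.I * v) = E⁻¹ := by
    rw [hE, ← Complex.exp_neg]; ring_nf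
  have hE1 : 1 - E ≠ 0 := by
    intro h
    have h' : Complex.exp (2 * Real.pi * Complex.I * v) = 1 := by rw [← hE]; linear_combination -h
    obtain ⟨k, hk⟩ := Complex.exp_eq_one_iff.1 h'
    refine hmem ⟨k, ?_⟩
    have hp : (2 * (Real.pi : ℂ) * Complex.I) ≠ 0 := Complex.two_pi_I_ne_zero
    exact mul_left_cancel₀ hp (by rw [hk]; ring)
  rw [hinv]
  have hI := Complex.I_ne_zero
  field_simp
  linear_combination (1 + E) * Complex.I_sq

/-- From `|e^t - 1| ≤ |t| e^|t|` the quotient `t/(e^t - 1)` is at least `e^(-|t|)` in modulus, and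
`|t| = 2π‖v‖ < 6π`. -/
lemma le_norm_bernGen {v : ℂ} (hv : ‖v‖ < 3) (h0 : v ≠ 0) (h1 : v ≠ 1) (h1' : v ≠ -1)
    (h2 : v ≠ 2) (h2' : v ≠ -2) : Real.exp (-(6 * Real.pi)) ≤ ‖bernGen v‖ := by
  have h := congrArg norm (bernGen_mul hv h0 h1 h1' h2 h2')
  set t : ℂ := -2 * Real.pi * Complex.I * v with ht
  have htn : ‖t‖ = 2 * Real.pi * ‖v‖ := by
    simp [ht, abs_of_pos Real.pi_pos]
  have hv0 : 0 < ‖v‖ := norm_pos_iff.2 h0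
  have ht0 : 0 < ‖t‖ := by rw [htn]; have := Real.pi_pos; positivity
  have hle : ‖Complex.exp t - 1‖ ≤ ‖t‖ * Real.exp ‖t‖ := by
    simpa using Complex.norm_exp_sub_sum_le_norm_mul_exp t 1
  have hle2 : Real.exp ‖t‖ ≤ Real.exp (6 * Real.pi) := by
    apply Real.exp_le_exp.2
    rw [htn]; nlinarith [Real.pi_pos]
  rw [norm_mul] at h
  rw [Real.exp_neg, inv_eq_one_div, div_le_iff₀ (Real.exp_pos _)]
  have : ‖t‖ ≤ ‖bernGen v‖ * (‖t‖ * Real.exp (6 * Real.pi)) := by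
    calc _ = ‖bernGen v‖ * ‖Complex.exp t - 1‖ := h.symm
      _ ≤ _ := by gcongr; exact hle.trans (by gcongr)
  nlinarith

/-! ### Approximation of the rescaled Bernoulli polynomial -/

/-- The Bernoulli polynomial `B_n(n z)`, up to a nonzero factor, in the variable `s = -2 π i z`. -/
noncomputable def bernSum (n : ℕ) (s : ℂ) : ℂ :=
  ∑ k ∈ range (n + 1), bernCoeff k * ((n * s) ^ (n - k) / ((n - k).factorial : ℂ))

/-- The analogue of `bernSum` for the coefficients `remCoeff`. -/
noncomputable def remSum (n : ℕ) (s : ℂ) : ℂ :=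
  ∑ k ∈ range (n + 1), remCoeff k * ((n * s) ^ (n - k) / ((n - k).factorial : ℂ))

/-- The contribution of the poles `± 2 π i`. -/
noncomputable def twoExp (n : ℕ) (s : ℂ) : ℂ :=
  Complex.exp (n * s) + (-1) ^ n * Complex.exp (n * -s)

lemma bernSum_eq_aeval (n : ℕ) (z : ℂ) :
    bernSum n (-2 * Real.pi * Complex.I * z) = (-2 * Real.pi * Complex.I) ^ n / (n.factorial : ℂ) *
      Polynomial.aeval ((n : ℂ) * z) (Polynomial.bernoulli n) := by
  rw [Polynomial.bernoulli, map_sum, mul_sum, bernSum]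
  refine sum_congr rfl fun k hk => ?_
  have hk : k ≤ n := by simpa [Nat.lt_succ_iff] using hk
  have hc : (n.choose k : ℂ) = n.factorial / (k.factorial * (n - k).factorial) := by
    rw [eq_div_iff (by simp [Nat.factorial_ne_zero]), ← Nat.choose_mul_factorial_mul_factorial hk]
    push_cast; ring
  have hf : (n.factorial : ℂ) ≠ 0 := by simp [Nat.factorial_ne_zero]
  rw [Polynomial.aeval_monomial, bernCoeff]
  set a : ℂ := -2 * Real.pi * Complex.I
  rw [show (n : ℂ) * (a * z) = a * (n * z) by ring, mul_pow a]
  rw [show a ^ n = a ^ k * a ^ (n - k) by rw [← pow_add, Nat.add_sub_cancel' hk]]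
  simp only [map_mul, map_natCast, eq_ratCast, hc]
  field_simp

/-- A simple pole at `b = 1/a` has geometric Taylor coefficients `a^k`, and so contributes a dilated
truncated exponential. -/
lemma sum_pow_eq_expTrunc (n : ℕ) {a b : ℂ} (hab : a * b = 1) (s : ℂ) :
    ∑ k ∈ range (n + 1), a ^ k * ((n * s) ^ (n - k) / ((n - k).factorial : ℂ)) =
      a ^ n * expTrunc n (n * (b * s)) := by
  rw [expTrunc, ← sum_range_reflect, mul_sum]
  refine sum_congr rfl fun k hk => ?_
  have hk : k ≤ n := by simpa [Nat.lt_succ_iff] using hk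
  rw [show n + 1 - 1 - k = n - k by omega, show n - (n - k) = k by omega, ← mul_div_assoc,
    ← mul_div_assoc, show a ^ n = a ^ (n - k) * a ^ k by rw [← pow_add, Nat.sub_add_cancel hk],
    mul_assoc, ← mul_pow a, show a * (n * (b * s)) = (a * b) * (n * s) by ring, hab, one_mul]

lemma bernSum_eq (n : ℕ) (s : ℂ) :
    bernSum n s = remSum n s - expTrunc n (n * s) - (-1) ^ n * expTrunc n (n * -s)
      - (1 / 2) ^ n * expTrunc n (n * (2 * s)) - (-1 / 2) ^ n * expTrunc n (n * (-2 * s)) := by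
  have h1 := sum_pow_eq_expTrunc n (a := 1) (b := 1) (by norm_num) s
  have h2 := sum_pow_eq_expTrunc n (a := -1) (b := -1) (by norm_num) s
  have h3 := sum_pow_eq_expTrunc n (a := 1 / 2) (b := 2) (by norm_num) s
  have h4 := sum_pow_eq_expTrunc n (a := -1 / 2) (b := -2) (by norm_num) s
  rw [one_pow, one_mul, one_mul] at h1
  rw [neg_one_mul] at h2
  rw [← h1, ← h2, ← h3, ← h4, remSum, bernSum]
  simp only [← sum_sub_distrib, remCoeff]
  refine sum_congr rfl fun k _ => ?_
  ring

lemma remSum_eq {n : ℕ} (hn : 1 ≤ n) {s : ℂ} (hs : s ≠ 0) :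
    remSum n s = topTerm n s * ∑' k, remCoeff k * fallRatio n k * s⁻¹ ^ k := by
  rw [tsum_eq_sum (s := range (n + 1)) fun k hk => by
    rw [fallRatio_eq_zero hn (by simpa [Nat.lt_succ_iff] using hk)]; simp, remSum, mul_sum]
  refine sum_congr rfl fun k hk => ?_
  have hk : k ≤ n := by simpa [Nat.lt_succ_iff] using hk
  have h : (n : ℂ) ^ (n - k) / ((n - k).factorial : ℂ) =
      n ^ n / (n.factorial : ℂ) * fallRatio n k := by
    simpa using congrArg Complex.ofReal (pow_div_factorial_sub hn hk)
  have h2 : s ^ (n - k) = s ^ n * s⁻¹ ^ k := by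
    rw [inv_pow, ← div_eq_mul_inv, eq_div_iff (pow_ne_zero _ hs), ← pow_add,
      Nat.sub_add_cancel hk]
  rw [mul_pow, mul_div_right_comm, h, topTerm, mul_pow, h2]
  ring

lemma norm_inv_le_of_le {s : ℂ} (hs : 36 / 100 ≤ ‖s‖) : ‖s⁻¹‖ ≤ 100 / 36 := by
  rw [norm_inv]
  exact (inv_anti₀ (by norm_num) hs).trans_eq (by norm_num)

/-- The threshold `0.36` exceeds `1/3`, which puts `s⁻¹` inside the disc of convergence, and is
below `1/e`, the least modulus on the curve. The ratio `100/108` is `(1/3)/0.36`. The third bound is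
crude and serves the small `s`. -/
lemma exists_remSum_bound : ∃ C : ℝ, 0 < C ∧
    (∀ n : ℕ, 1 ≤ n → ∀ s : ℂ, 36 / 100 ≤ ‖s‖ → ‖remSum n s‖ ≤ C * ‖topTerm n s‖) ∧
    (∀ n : ℕ, 1 ≤ n → ∀ s : ℂ, 36 / 100 ≤ ‖s‖ →
      ‖remSum n s - topTerm n s * ∑' k, remCoeff k * s⁻¹ ^ k‖ ≤ C / √n * ‖topTerm n s‖) ∧
    (∀ (n : ℕ) (s : ℂ), ‖remSum n s‖ ≤ C * ((1 / 3) ^ n * Real.exp (3 * n * ‖s‖))) := by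
  obtain ⟨C, hC, hq⟩ := exists_remCoeff_bound
  have hr : Summable fun k : ℕ => (100 / 108 : ℝ) ^ k :=
    summable_geometric_of_lt_one (by norm_num) (by norm_num)
  have hr2 : Summable fun k : ℕ => (k : ℝ) ^ 2 * (100 / 108 : ℝ) ^ k :=
    summable_pow_mul_geometric_of_norm_lt_one 2 (by norm_num)
  set S := ∑' k : ℕ, (100 / 108 : ℝ) ^ k
  set S2 := ∑' k : ℕ, (k : ℝ) ^ 2 * (100 / 108 : ℝ) ^ k
  have hS : 0 ≤ S := tsum_nonneg fun _ => by positivity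
  have hS2 : 0 ≤ S2 := tsum_nonneg fun _ => by positivity
  have hterm : ∀ (s : ℂ), 36 / 100 ≤ ‖s‖ → ∀ k, ‖remCoeff k‖ * ‖s⁻¹‖ ^ k ≤
      C * (100 / 108) ^ k := fun s hs k => by
    calc _ ≤ C * (1 / 3) ^ k * (100 / 36) ^ k := by
          gcongr
          · exact hq k
          · exact norm_inv_le_of_le hs
      _ = _ := by rw [mul_assoc, ← mul_pow]; norm_num
  refine ⟨C * S + C * S2 + C, by positivity, fun n hn s hs => ?_, fun n hn s hs => ?_,
    fun n s => ?_⟩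
  · have h0 : s ≠ 0 := norm_pos_iff.1 (by linarith)
    rw [remSum_eq hn h0, norm_mul, mul_comm]
    gcongr
    have : ‖∑' k, remCoeff k * fallRatio n k * s⁻¹ ^ k‖ ≤ C * S := by
      refine tsum_of_norm_bounded (hr.hasSum.mul_left C) fun k => ?_
      rw [norm_mul, norm_mul, norm_pow, Complex.norm_real,
        Real.norm_of_nonneg (fallRatio_nonneg n k hn), mul_right_comm]
      exact (mul_le_of_le_one_right (by positivity) ((slowDecay_fallRatio hn).le_one k)).trans
        (hterm s hs k)
    nlinarith
  · have h0 : s ≠ 0 := norm_pos_iff.1 (by linarith)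
    have hn' : (1 : ℝ) ≤ n := by exact_mod_cast hn
    have hs1 : 1 ≤ √(n : ℝ) := Real.one_le_sqrt.2 hn'
    have hs2 : √(n : ℝ) * √n = n := Real.mul_self_sqrt (by positivity)
    have hv : ‖s⁻¹‖ < 3 := (norm_inv_le_of_le hs).trans_lt (by norm_num)
    have hsum1 : Summable fun k => remCoeff k * fallRatio n k * s⁻¹ ^ k := by
      refine Summable.of_norm_bounded (hr.mul_left C) fun k => ?_
      rw [norm_mul, norm_mul, norm_pow, Complex.norm_real,
        Real.norm_of_nonneg (fallRatio_nonneg n k hn), mul_right_comm]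
      exact (mul_le_of_le_one_right (by positivity) ((slowDecay_fallRatio hn).le_one k)).trans
        (hterm s hs k)
    rw [remSum_eq hn h0, ← mul_sub, ← hsum1.tsum_sub (summable_remCoeff hv), norm_mul, mul_comm]
    gcongr
    have : ‖∑' k, (remCoeff k * fallRatio n k * s⁻¹ ^ k - remCoeff k * s⁻¹ ^ k)‖ ≤
        C / n * S2 := by
      refine tsum_of_norm_bounded (hr2.hasSum.mul_left (C / n)) fun k => ?_
      have e : remCoeff k * fallRatio n k * s⁻¹ ^ k - remCoeff k * s⁻¹ ^ k =
          -(remCoeff k * s⁻¹ ^ k * ((1 - fallRatio n k : ℝ) : ℂ)) := by push_cast; ring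
      rw [e, norm_neg, norm_mul, norm_mul, norm_pow, Complex.norm_real,
        Real.norm_of_nonneg (sub_nonneg.2 ((slowDecay_fallRatio hn).le_one k))]
      calc _ ≤ C * (100 / 108) ^ k * ((k : ℝ) ^ 2 / n) := by
            exact mul_le_mul (hterm s hs k) (one_sub_fallRatio_le hn k)
              (sub_nonneg.2 ((slowDecay_fallRatio hn).le_one k)) (by positivity)
        _ = _ := by ring
    calc _ ≤ C / n * S2 := this
      _ = C * S2 / n := by ring
      _ ≤ C * S2 / √n := by
          gcongr
          nlinarith
      _ ≤ _ := by
          gcongr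
          nlinarith
  · calc ‖remSum n s‖ ≤ ∑ k ∈ range (n + 1), ‖remCoeff k *
          ((n * s) ^ (n - k) / ((n - k).factorial : ℂ))‖ := norm_sum_le _ _
      _ ≤ ∑ k ∈ range (n + 1), C * (1 / 3) ^ n *
          ((3 * n * ‖s‖) ^ (n - k) / ((n - k).factorial : ℝ)) := by
          refine sum_le_sum fun k hk => ?_
          have hk : k ≤ n := by simpa [Nat.lt_succ_iff] using hk
          rw [norm_mul, norm_div, norm_pow, norm_mul, Complex.norm_natCast, Complex.norm_natCast]
          calc _ ≤ C * (1 / 3) ^ k * ((n * ‖s‖) ^ (n - k) / ((n - k).factorial : ℝ)) := by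
                gcongr; exact hq k
            _ = _ := by
                rw [show (1 / 3 : ℝ) ^ n = (1 / 3) ^ k * (1 / 3) ^ (n - k) by
                  rw [← pow_add, Nat.add_sub_cancel' hk], mul_assoc (3 : ℝ), mul_pow (3 : ℝ)]
                have : (1 / 3 : ℝ) ^ (n - k) * 3 ^ (n - k) = 1 := by
                  rw [← mul_pow]; norm_num
                linear_combination -(C * (1 / 3) ^ k * ((n * ‖s‖) ^ (n - k) /
                  ((n - k).factorial : ℝ))) * this
      _ = C * (1 / 3) ^ n * ∑ k ∈ range (n + 1), (3 * n * ‖s‖) ^ k / (k.factorial : ℝ) := by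
          rw [← mul_sum, ← sum_range_reflect]
          congr 1
          refine sum_congr rfl fun k hk => ?_
          have hk : k ≤ n := by simpa [Nat.lt_succ_iff] using hk
          rw [show n - (n + 1 - 1 - k) = k by omega]
      _ ≤ C * (1 / 3) ^ n * Real.exp (3 * n * ‖s‖) := by
          gcongr
          exact Real.sum_le_exp_of_nonneg (by positivity) _
      _ ≤ _ := by
          rw [mul_assoc]
          gcongr
          nlinarith [mul_nonneg hC.le hS, mul_nonneg hC.le hS2]

/-- The poles `±2` contribute exponentials negligible against `e^(n|Re s|)`: here `|Re σ| ≤ 1/2`,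
and `e^(1/2)/2 < 0.99`. -/
lemma norm_half_pow_mul_exp_le (n : ℕ) {σ : ℂ} (hσ : ‖2 * σ‖ ≤ 1) :
    (1 / 2) ^ n * ‖Complex.exp (n * (2 * σ))‖ ≤ (99 / 100) ^ n * Real.exp (n * |σ.re|) := by
  have h1 : |σ.re| ≤ 1 / 2 := by
    have := Complex.abs_re_le_norm σ
    rw [norm_mul, RCLike.norm_ofNat] at hσ
    linarith
  have h2 : Real.exp (1 / 2) ≤ 2 * (99 / 100) := by
    have h := Real.exp_one_lt_d9
    have h3 : Real.exp (1 / 2) ^ 2 = Real.exp 1 := by rw [← Real.exp_nat_mul]; norm_num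
    nlinarith [Real.exp_pos (1 / 2)]
  have h4 : Real.exp (σ.re * 2) ≤ 2 * (99 / 100) * Real.exp |σ.re| := by
    calc Real.exp (σ.re * 2) ≤ Real.exp (1 / 2 + |σ.re|) := by
          apply Real.exp_le_exp.2
          linarith [le_abs_self σ.re]
      _ ≤ _ := by rw [Real.exp_add]; gcongr
  rw [Complex.norm_exp, show ((n : ℂ) * (2 * σ)).re = n * (σ.re * 2) by
      rw [← Complex.ofReal_natCast, Complex.re_ofReal_mul]; simp [mul_comm],
    Real.exp_nat_mul, Real.exp_nat_mul, ← mul_pow, ← mul_pow]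
  exact pow_le_pow_left₀ (by positivity) (by linarith) n

lemma norm_half_pow_expTrunc_le {n : ℕ} (hn : 1 ≤ n) (σ : ℂ) :
    (1 / 2) ^ n * ‖expTrunc n (n * (2 * σ))‖ ≤
      4 * √n * ‖topTerm n σ‖ + (99 / 100) ^ n * Real.exp (n * |σ.re|) := by
  have htop : (1 / 2 : ℝ) ^ n * (4 * √n * ‖topTerm n (2 * σ)‖) = 4 * √n * ‖topTerm n σ‖ := by
    rw [topTerm_mul, norm_mul, norm_pow, RCLike.norm_ofNat]
    have : (1 / 2 : ℝ) ^ n * 2 ^ n = 1 := by rw [← mul_pow]; norm_num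
    linear_combination (4 * √n * ‖topTerm n σ‖) * this
  rcases le_total ‖2 * σ‖ 1 with h | h
  · have h1 := norm_expTrunc_sub_exp_le hn h
    have h2 : ‖expTrunc n (n * (2 * σ))‖ ≤ 4 * √n * ‖topTerm n (2 * σ)‖ +
        ‖Complex.exp (n * (2 * σ))‖ := by
      have := norm_add_le (expTrunc n (n * (2 * σ)) - Complex.exp (n * (2 * σ)))
        (Complex.exp (n * (2 * σ)))
      rw [sub_add_cancel] at this
      linarith
    calc _ ≤ (1 / 2) ^ n * (4 * √n * ‖topTerm n (2 * σ)‖ + ‖Complex.exp (n * (2 * σ))‖) := by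
          gcongr
      _ ≤ _ := by
          rw [mul_add, htop]
          exact add_le_add_right (norm_half_pow_mul_exp_le n h) _
  · calc _ ≤ (1 / 2 : ℝ) ^ n * (4 * √n * ‖topTerm n (2 * σ)‖) := by
          gcongr
          exact norm_expTrunc_le hn h
      _ ≤ _ := by rw [htop]; linarith [show 0 ≤ (99 / 100 : ℝ) ^ n * Real.exp (n * |σ.re|) by positivity]

/-- Inside the zero curve the polynomial is approximated by the contribution of two poles. -/
lemma exists_bernSum_add_twoExp_bound : ∃ C : ℝ, 0 < C ∧ ∀ n : ℕ, 1 ≤ n → ∀ s : ℂ, ‖s‖ ≤ 1 →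
    ‖bernSum n s + twoExp n s‖ ≤
      C * (√n * ‖topTerm n s‖ + (99 / 100) ^ n * Real.exp (n * |s.re|)) := by
  obtain ⟨C, hC, hb1, -, hb3⟩ := exists_remSum_bound
  refine ⟨C + 16, by linarith, fun n hn s hs => ?_⟩
  have hs1 : 1 ≤ √(n : ℝ) := Real.one_le_sqrt.2 (by exact_mod_cast hn)
  have hneg : ‖topTerm n (-s)‖ = ‖topTerm n s‖ := by simp [norm_topTerm]
  have e : bernSum n s + twoExp n s = remSum n s - (expTrunc n (n * s) - Complex.exp (n * s))
      - (-1) ^ n * (expTrunc n (n * -s) - Complex.exp (n * -s))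
      - (1 / 2) ^ n * expTrunc n (n * (2 * s)) - (-1 / 2) ^ n * expTrunc n (n * (2 * -s)) := by
    rw [bernSum_eq, twoExp, show 2 * -s = -2 * s by ring]; ring
  have h1 := norm_expTrunc_sub_exp_le hn hs
  have h2 := norm_expTrunc_sub_exp_le hn (σ := -s) (by simpa using hs)
  have h3 := norm_half_pow_expTrunc_le hn s
  have h4 := norm_half_pow_expTrunc_le hn (-s)
  rw [hneg] at h2 h4
  rw [Complex.neg_re, abs_neg] at h4
  set X := ‖topTerm n s‖ with hX
  set Y := (99 / 100 : ℝ) ^ n * Real.exp (n * |s.re|) with hY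
  have hX0 : 0 ≤ X := norm_nonneg _
  have hY0 : 0 ≤ Y := by positivity
  have h5 : ‖remSum n s‖ ≤ C * (√n * X + Y) := by
    rcases le_total (36 / 100) ‖s‖ with h | h
    · calc _ ≤ C * X := hb1 n hn s h
        _ ≤ _ := by gcongr; nlinarith
    -- For `‖s‖ ≤ 0.36` the crude bound suffices, because `e^(1.08)/3 < 0.99`.
    · refine (hb3 n s).trans ?_
      gcongr
      have h6 : Real.exp (3 * n * ‖s‖) ≤ (3 * (99 / 100)) ^ n := by
        rw [mul_comm (3 : ℝ), mul_assoc, Real.exp_nat_mul]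
        gcongr
        have h7 : Real.exp (8 / 100) ≤ 1 / (1 - 8 / 100) :=
          Real.exp_bound_div_one_sub_of_interval (by norm_num) (by norm_num)
        calc Real.exp (3 * ‖s‖) ≤ Real.exp (1 + 8 / 100) := by
              apply Real.exp_le_exp.2; linarith
          _ ≤ 2.7182818286 * (1 / (1 - 8 / 100)) := by
              rw [Real.exp_add]
              gcongr
              exact Real.exp_one_lt_d9.le
          _ ≤ _ := by norm_num
      calc (1 / 3 : ℝ) ^ n * Real.exp (3 * n * ‖s‖) ≤ (1 / 3) ^ n * (3 * (99 / 100)) ^ n := by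
            gcongr
        _ = (99 / 100) ^ n * 1 := by rw [← mul_pow]; norm_num
        _ ≤ Y := by
            rw [hY]; gcongr
            exact Real.one_le_exp (by positivity)
        _ ≤ _ := by nlinarith
  rw [e]
  calc _ ≤ ‖remSum n s‖ + ‖expTrunc n (n * s) - Complex.exp (n * s)‖
        + ‖(-1) ^ n * (expTrunc n (n * -s) - Complex.exp (n * -s))‖
        + ‖(1 / 2 : ℂ) ^ n * expTrunc n (n * (2 * s))‖
        + ‖(-1 / 2 : ℂ) ^ n * expTrunc n (n * (2 * -s))‖ := by
        refine (norm_sub_le _ _).trans (add_le_add_left ?_ _)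
        refine (norm_sub_le _ _).trans (add_le_add_left ?_ _)
        refine (norm_sub_le _ _).trans (add_le_add_left ?_ _)
        exact norm_sub_le _ _
    _ ≤ C * (√n * X + Y) + 4 * √n * X + 4 * √n * X + (4 * √n * X + Y) + (4 * √n * X + Y) := by
        have n1 : ‖(1 / 2 : ℂ) ^ n‖ = (1 / 2) ^ n := by simp
        have n2 : ‖(-1 / 2 : ℂ) ^ n‖ = (1 / 2) ^ n := by simp
        have n3 : ‖(-1 : ℂ) ^ n‖ = 1 := by simp
        rw [norm_mul ((1 / 2 : ℂ) ^ n), norm_mul ((-1 / 2 : ℂ) ^ n), norm_mul ((-1 : ℂ) ^ n),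
          n1, n2, n3, one_mul]
        gcongr
    _ ≤ _ := by nlinarith

/-- The main terms of the four truncated exponentials cancel the four poles of `bernGen`, because
`a^n topTerm n (s/a) = topTerm n s`. The free `a b c d` are to be an exponential or `0`, according
to which side of the unit circle each argument lies on. -/
lemma bernSum_sub_bernGen_eq (n : ℕ) (s a b c d : ℂ) :
    bernSum n s + (a + (-1) ^ n * b + (1 / 2) ^ n * c + (-1 / 2) ^ n * d)
        - topTerm n s * bernGen s⁻¹ =
      (remSum n s - topTerm n s * ∑' k, remCoeff k * s⁻¹ ^ k)
      - (expTrunc n (n * s) - a - topTerm n s * (1 / (1 - s⁻¹)))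
      - (-1) ^ n * (expTrunc n (n * -s) - b - topTerm n (-s) * (1 / (1 - (-s)⁻¹)))
      - (1 / 2) ^ n * (expTrunc n (n * (2 * s)) - c - topTerm n (2 * s) * (1 / (1 - (2 * s)⁻¹)))
      - (-1 / 2) ^ n *
        (expTrunc n (n * (-2 * s)) - d - topTerm n (-2 * s) * (1 / (1 - (-2 * s)⁻¹))) := by
  have h1 : (-1 : ℂ) ^ n * topTerm n (-s) = topTerm n s := by
    rw [← neg_one_mul s, topTerm_mul, ← mul_assoc, ← mul_pow]; norm_num
  have h2 : (1 / 2 : ℂ) ^ n * topTerm n (2 * s) = topTerm n s := by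
    rw [topTerm_mul, ← mul_assoc, ← mul_pow]; norm_num
  have h3 : (-1 / 2 : ℂ) ^ n * topTerm n (-2 * s) = topTerm n s := by
    rw [topTerm_mul, ← mul_assoc, ← mul_pow]; norm_num
  rw [bernSum_eq, bernGen, mul_inv, mul_inv, inv_neg, show (2 : ℂ)⁻¹ * s⁻¹ = s⁻¹ / 2 by ring,
    show (-2 : ℂ)⁻¹ * s⁻¹ = -(s⁻¹ / 2) by rw [inv_neg]; ring, sub_neg_eq_add, sub_neg_eq_add]
  linear_combination -(1 / (1 + s⁻¹)) * h1 - 1 / (1 - s⁻¹ / 2) * h2 - 1 / (1 + s⁻¹ / 2) * h3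

lemma norm_four_sub_le {n : ℕ} {X a b c d : ℂ} {x r₁ r₂ r₃ r₄ : ℝ} (hX : ‖X‖ ≤ x)
    (ha : ‖a‖ ≤ r₁) (hb : ‖b‖ ≤ r₂) (hc : (1 / 2) ^ n * ‖c‖ ≤ r₃) (hd : (1 / 2) ^ n * ‖d‖ ≤ r₄) :
    ‖X - a - (-1) ^ n * b - (1 / 2) ^ n * c - (-1 / 2) ^ n * d‖ ≤ x + r₁ + r₂ + r₃ + r₄ := by
  refine (norm_sub_le _ _).trans (add_le_add ?_ (by simpa using hd))
  refine (norm_sub_le _ _).trans (add_le_add ?_ (by simpa using hc))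
  refine (norm_sub_le _ _).trans (add_le_add ?_ (by simpa using hb))
  exact (norm_sub_le _ _).trans (add_le_add hX ha)

lemma half_pow_mul_norm_topTerm (n : ℕ) {a s : ℂ} (ha : ‖a‖ = 2) :
    (1 / 2) ^ n * ‖topTerm n (a * s)‖ = ‖topTerm n s‖ := by
  rw [topTerm_mul, norm_mul, norm_pow, ha, ← mul_assoc, ← mul_pow]; norm_num

/-- Outside the unit disc the polynomial is approximated by the generating function. -/
lemma exists_bernSum_sub_bound_of_one_le {ε : ℝ} (hε : 0 < ε) : ∃ C : ℝ, 0 < C ∧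
    ∀ n : ℕ, 1 ≤ n → ∀ s : ℂ, 1 ≤ ‖s‖ → ε ≤ ‖1 - s⁻¹‖ → ε ≤ ‖1 + s⁻¹‖ →
      ‖bernSum n s - topTerm n s * bernGen s⁻¹‖ ≤ C / √n * ‖topTerm n s‖ := by
  obtain ⟨C, hC, -, hb, -⟩ := exists_remSum_bound
  -- `26/ε²` comes from the arguments `±s`, and `104 = 2·13·4` from `±2s`, where the distance to the
  -- pole is at least `1/2`.
  refine ⟨C + 26 / ε ^ 2 + 104, by positivity, fun n hn s hs h1 h2 => ?_⟩
  have hs0 : 0 < √(n : ℝ) := Real.sqrt_pos.2 (by exact_mod_cast hn)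
  set X := ‖topTerm n s‖ with hX
  have hX0 : 0 ≤ X := norm_nonneg _
  have hinv : ‖s⁻¹‖ ≤ 1 := by rw [norm_inv]; exact inv_le_one_of_one_le₀ hs
  have base : ∀ (σ : ℂ) (δ : ℝ), 0 < δ → 1 ≤ ‖σ‖ → δ ≤ ‖1 - σ⁻¹‖ →
      ‖expTrunc n (n * σ) - 0 - topTerm n σ * (1 / (1 - σ⁻¹))‖ ≤
        13 / (√n * δ ^ 2) * ‖topTerm n σ‖ := fun σ δ hδ h h' => by
    rw [sub_zero]
    refine (norm_expTrunc_sub_le_of_ge hn h ?_).trans ?_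
    · rintro rfl; simp at h'; linarith
    · gcongr
  have e := bernSum_sub_bernGen_eq n s 0 0 0 0
  simp only [mul_zero, add_zero] at e
  have hneg : ‖topTerm n (-s)‖ = X := by simp [hX, norm_topTerm]
  have half : ∀ a : ℂ, ‖a‖ = 2 → (1 / 2) ^ n *
      ‖expTrunc n (n * (a * s)) - 0 - topTerm n (a * s) * (1 / (1 - (a * s)⁻¹))‖ ≤
        13 / (√n * (1 / 2) ^ 2) * X := fun a ha => by
    have h3 := base (a * s) (1 / 2) (by norm_num) (by rw [norm_mul, ha]; linarith) (by
      have := norm_sub_norm_le 1 ((a * s)⁻¹)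
      rw [mul_inv, norm_mul, norm_inv a, ha, norm_one] at this
      rw [mul_inv]
      linarith)
    calc _ ≤ (1 / 2) ^ n * (13 / (√n * (1 / 2) ^ 2) * ‖topTerm n (a * s)‖) := by gcongr
      _ = _ := by rw [mul_left_comm, half_pow_mul_norm_topTerm n ha]
  rw [e]
  refine (norm_four_sub_le (hb n hn s (by linarith)) (base s ε hε hs h1)
    (base (-s) ε hε (by simpa using hs) (by simpa [inv_neg] using h2))
    (half 2 (by simp)) (half (-2) (by simp))).trans (le_of_eq ?_)
  rw [hneg]
  field_simp
  ring

/-- In the unit disc the polynomial is approximated by the generating function and two poles. -/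
lemma exists_bernSum_sub_bound_of_le_one {ε : ℝ} (hε : 0 < ε) : ∃ C : ℝ, 0 < C ∧
    ∀ n : ℕ, 1 ≤ n → ∀ s : ℂ, 36 / 100 ≤ ‖s‖ → ‖s‖ ≤ 1 → ε ≤ ‖1 - s‖ → ε ≤ ‖1 + s‖ →
      ε ≤ ‖1 - 2 * s‖ → ε ≤ ‖1 + 2 * s‖ →
      ‖bernSum n s + twoExp n s - topTerm n s * bernGen s⁻¹‖ ≤
        C / √n * ‖topTerm n s‖ + 2 * ((99 / 100) ^ n * Real.exp (n * |s.re|)) := by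
  obtain ⟨C, hC, -, hb, -⟩ := exists_remSum_bound
  refine ⟨C + 13 * (2 / ε ^ 2 + 8 / ε ^ 2), by positivity,
    fun n hn s hs hs' h1 h2 h3 h4 => ?_⟩
  have hs0 : 0 < √(n : ℝ) := Real.sqrt_pos.2 (by exact_mod_cast hn)
  set X := ‖topTerm n s‖ with hX
  set Y := (99 / 100 : ℝ) ^ n * Real.exp (n * |s.re|) with hY
  have hX0 : 0 ≤ X := norm_nonneg _
  have hY0 : 0 ≤ Y := by positivity
  have hsne : s ≠ 0 := norm_pos_iff.1 (by linarith)
  have base : ∀ σ : ℂ, σ ≠ 0 → ‖σ‖ ≤ 1 → ε ≤ ‖1 - σ‖ →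
      ‖expTrunc n (n * σ) - Complex.exp (n * σ) - topTerm n σ * (1 / (1 - σ⁻¹))‖ ≤
        13 / (√n * ε ^ 2) * ‖topTerm n σ‖ := fun σ h0 h h' => by
    refine (norm_expTrunc_sub_le_of_le hn h ?_ h0).trans ?_
    · rintro rfl; simp at h'; linarith
    · gcongr
  have hneg : ‖topTerm n (-s)‖ = X := by simp [hX, norm_topTerm]
  -- The subtracted `c` is the exponential when `‖a * s‖ ≤ 1` and `0` otherwise; either way it fits
  -- in the error `Y`. Outside the disc `1 - (as)⁻¹ = -(1 - as)/(as)` with `‖a * s‖ ≤ 2`, hence `ε /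
  -- 2`.
  have half : ∀ a : ℂ, a = 2 ∨ a = -2 → ε ≤ ‖1 - a * s‖ → ∃ c : ℂ, (1 / 2) ^ n * ‖c‖ ≤ Y ∧
      (1 / 2) ^ n * ‖expTrunc n (n * (a * s)) - c - topTerm n (a * s) * (1 / (1 - (a * s)⁻¹))‖ ≤
        13 / (√n * (ε / 2) ^ 2) * X := by
    intro a ha2 hdist
    have ha : ‖a‖ = 2 := by rcases ha2 with rfl | rfl <;> simp
    have key : ∃ c : ℂ, (1 / 2) ^ n * ‖c‖ ≤ Y ∧
      ‖expTrunc n (n * (a * s)) - c - topTerm n (a * s) * (1 / (1 - (a * s)⁻¹))‖ ≤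
        13 / (√n * (ε / 2) ^ 2) * ‖topTerm n (a * s)‖ := by
      have hn2 : ‖a * s‖ ≤ 2 := by rw [norm_mul, ha]; linarith
      have hpos : 0 < ‖a * s‖ := by rw [norm_mul, ha]; linarith
      have hne1 : a * s ≠ 1 := fun h => by rw [h] at hdist; simp at hdist; linarith
      rcases le_total ‖a * s‖ 1 with h | h
      · refine ⟨Complex.exp (n * (a * s)), ?_, (base _ (norm_pos_iff.1 hpos) h hdist).trans ?_⟩
        · rcases ha2 with rfl | rfl
          · exact norm_half_pow_mul_exp_le n h
          · rw [show -2 * s = 2 * -s by ring] at h ⊢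
            simpa [hY] using norm_half_pow_mul_exp_le n h
        · have : ε / 2 ≤ ε := by linarith
          gcongr
      · refine ⟨0, by simpa using hY0, ?_⟩
        rw [sub_zero]
        refine (norm_expTrunc_sub_le_of_ge hn h hne1).trans ?_
        have : ε / 2 ≤ ‖1 - (a * s)⁻¹‖ := by
          have e : 1 - (a * s)⁻¹ = -((1 - a * s) / (a * s)) := by
            rw [← neg_div, neg_sub, sub_div, div_self (norm_pos_iff.1 hpos), one_div]
          rw [e, norm_neg, norm_div]
          gcongr
        gcongr
    obtain ⟨c, hc1, hc2⟩ := key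
    refine ⟨c, hc1, ?_⟩
    calc _ ≤ (1 / 2) ^ n * (13 / (√n * (ε / 2) ^ 2) * ‖topTerm n (a * s)‖) := by gcongr
      _ = _ := by rw [mul_left_comm, half_pow_mul_norm_topTerm n ha]
  obtain ⟨c, hc1, hc2⟩ := half 2 (by simp) h3
  obtain ⟨d, hd1, hd2⟩ := half (-2) (by simp) (by rwa [neg_mul, sub_neg_eq_add])
  have e := bernSum_sub_bernGen_eq n s (Complex.exp (n * s)) (Complex.exp (n * -s)) c d
  have e2 : bernSum n s + twoExp n s - topTerm n s * bernGen s⁻¹ =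
      (bernSum n s + (Complex.exp (n * s) + (-1) ^ n * Complex.exp (n * -s) + (1 / 2) ^ n * c +
        (-1 / 2) ^ n * d) - topTerm n s * bernGen s⁻¹)
        - ((1 / 2) ^ n * c + (-1 / 2) ^ n * d) := by rw [twoExp]; ring
  rw [e2, e]
  have hcd : ‖(1 / 2) ^ n * c + (-1 / 2) ^ n * d‖ ≤ Y + Y :=
    (norm_add_le _ _).trans (add_le_add (by simpa using hc1) (by simpa using hd1))
  refine (norm_sub_le _ _).trans ((add_le_add (norm_four_sub_le (hb n hn s hs) (base s hsne hs' h1)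
    (base (-s) (neg_ne_zero.2 hsne) (by simpa using hs') (by simpa using h2))
    hc2 hd2) hcd).trans (le_of_eq ?_))
  rw [hneg]
  field_simp
  ring

end

/-! ### The Szegő arc and the zero-free regions -/

section

open Filter Topology

/-- The part of the Szegő-type curve `exp (Re s) = e |s|` in the right half of the unit disc. -/
def szegoArc : Set ℂ := {s : ℂ | 0 < s.re ∧ ‖s‖ ≤ 1 ∧ Real.exp s.re = Real.exp 1 * ‖s‖}

/-- The function `|s exp (1 - s)|`, whose level set of height `1` contains `szegoArc`. -/
noncomputable def szegoHeight (s : ℂ) : ℝ := ‖s‖ * Real.exp (1 - s.re)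

lemma continuous_szegoHeight : Continuous szegoHeight := by
  unfold szegoHeight
  fun_prop

lemma szegoHeight_mul_exp (s : ℂ) : szegoHeight s * Real.exp s.re = Real.exp 1 * ‖s‖ := by
  rw [szegoHeight, mul_assoc, ← Real.exp_add, sub_add_cancel, mul_comm]

lemma szegoHeight_eq_one_iff (s : ℂ) : szegoHeight s = 1 ↔ Real.exp s.re = Real.exp 1 * ‖s‖ := by
  rw [← szegoHeight_mul_exp]
  constructor
  · intro h; rw [h, one_mul]
  · intro h
    have := Real.exp_pos s.re
    nlinarith

/-- The two halves of the arc, parametrised by the real part. -/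
noncomputable def arcPath (σ v : ℝ) : ℂ := v + σ * √(Real.exp (2 * v - 2) - v ^ 2) * Complex.I

lemma continuous_arcPath (σ : ℝ) : Continuous (arcPath σ) := by
  unfold arcPath
  fun_prop

lemma arcPath_re (σ v : ℝ) : (arcPath σ v).re = v := by
  simp [arcPath]

lemma norm_arcPath {σ v : ℝ} (hσ : σ ^ 2 = 1) (hv : 0 ≤ v) :
    ‖arcPath σ v‖ = Real.exp (v - 1) := by
  have h1 : v ≤ Real.exp (v - 1) := by simpa using Real.add_one_le_exp (v - 1)
  have h2 : Real.exp (2 * v - 2) = Real.exp (v - 1) ^ 2 := by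
    rw [← Real.exp_nat_mul]; push_cast; ring_nf
  have h3 : 0 ≤ Real.exp (2 * v - 2) - v ^ 2 := by
    rw [h2]; nlinarith
  have hi : (arcPath σ v).im = σ * √(Real.exp (2 * v - 2) - v ^ 2) := by
    simp [arcPath]
  rw [← sq_eq_sq₀ (norm_nonneg _) (Real.exp_pos _).le, Complex.sq_norm, Complex.normSq_apply,
    arcPath_re, hi, ← h2]
  have := Real.mul_self_sqrt h3
  linear_combination σ ^ 2 * this + (Real.exp (2 * v - 2) - v ^ 2) * hσ

lemma arcPath_mem {σ v : ℝ} (hσ : σ ^ 2 = 1) (hv : v ∈ Set.Ioo (0 : ℝ) 1) :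
    arcPath σ v ∈ szegoArc \ {1} := by
  refine ⟨⟨by rw [arcPath_re]; exact hv.1, ?_, ?_⟩, fun h => ?_⟩
  · rw [norm_arcPath hσ hv.1.le]
    exact Real.exp_le_one_iff.2 (by linarith [hv.2])
  · rw [norm_arcPath hσ hv.1.le, arcPath_re, ← Real.exp_add]; ring_nf
  · have := congrArg Complex.re (Set.mem_singleton_iff.1 h)
    rw [arcPath_re, Complex.one_re] at this
    exact hv.2.ne this

lemma arcPath_mem_closure {σ v : ℝ} (hσ : σ ^ 2 = 1) (hv : v ∈ Set.Icc (0 : ℝ) 1) :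
    arcPath σ v ∈ closure (szegoArc \ {1}) :=
  map_mem_closure (continuous_arcPath σ) (by rwa [closure_Ioo zero_ne_one])
    fun _ h => arcPath_mem hσ h

lemma one_mem_closure_szegoArc : (1 : ℂ) ∈ closure (szegoArc \ {1}) := by
  have := arcPath_mem_closure (σ := 1) (v := 1) (by norm_num) (by simp)
  simpa [arcPath] using this

lemma one_mem_szegoArc : (1 : ℂ) ∈ szegoArc := by simp [szegoArc]

/-- Only `Re s = 0` needs an argument: there `s = ±i/e`, the endpoints that the strict inequality
leaves out of the arc, reached as limits of `arcPath`. -/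
lemma mem_closure_szegoArc {s : ℂ} (h0 : 0 ≤ s.re) (h1 : ‖s‖ ≤ 1) (h : szegoHeight s = 1) :
    s ∈ closure szegoArc := by
  rcases h0.lt_or_eq with hpos | hzero
  · exact subset_closure ⟨hpos, h1, (szegoHeight_eq_one_iff s).1 h⟩
  have hn : ‖s‖ = Real.exp (-1) := by
    rw [szegoHeight_eq_one_iff, ← hzero, Real.exp_zero] at h
    rw [Real.exp_neg]
    exact eq_inv_of_mul_eq_one_right h.symm
  have him : s.im ^ 2 = Real.exp (-1) ^ 2 := by
    rw [← hn, Complex.sq_norm, Complex.normSq_apply, ← hzero]; ring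
  have hpath : ∀ σ : ℝ, arcPath σ 0 = ((σ * Real.exp (-1) : ℝ) : ℂ) * Complex.I := fun σ => by
    have : Real.exp (2 * 0 - 2) - 0 ^ 2 = Real.exp (-1) ^ 2 := by
      rw [← Real.exp_nat_mul]; norm_num
    rw [arcPath, this, Real.sqrt_sq (Real.exp_pos _).le]
    push_cast
    ring
  have hs : ∃ σ : ℝ, σ ^ 2 = 1 ∧ s = arcPath σ 0 := by
    rcases sq_eq_sq_iff_eq_or_eq_neg.1 him with h | h
    · refine ⟨1, by norm_num, ?_⟩
      rw [hpath]; apply Complex.ext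
      · rw [Complex.re_ofReal_mul, ← hzero]; simp
      · rw [Complex.im_ofReal_mul, h]; simp
    · refine ⟨-1, by norm_num, ?_⟩
      rw [hpath]; apply Complex.ext
      · rw [Complex.re_ofReal_mul, ← hzero]; simp
      · rw [Complex.im_ofReal_mul, h]; simp
  obtain ⟨σ, hσ, rfl⟩ := hs
  exact closure_mono Set.sdiff_subset (arcPath_mem_closure hσ (by simp))

/-- Away from the arc the height is bounded away from `1`. -/
lemma exists_szegoHeight_gap {ε : ℝ} (hε : 0 < ε) : ∃ η : ℝ, 0 < η ∧ η ≤ 1 / 100 ∧ ∀ s : ℂ,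
    0 ≤ s.re → ‖s‖ ≤ 1 → (∀ w ∈ szegoArc, ε ≤ ‖s - w‖) →
      szegoHeight s ≤ 1 - η ∨ 1 + η ≤ szegoHeight s := by
  set K : Set ℂ := {s | ‖s‖ ≤ 1} ∩ ({s | 0 ≤ s.re} ∩ {s | ∀ w ∈ szegoArc, ε ≤ ‖s - w‖}) with hK
  have hKc : IsCompact K := by
    have h1 : IsCompact {s : ℂ | ‖s‖ ≤ 1} := by
      simpa [Metric.closedBall, dist_zero_right] using isCompact_closedBall (0 : ℂ) 1
    refine h1.inter_right ((isClosed_le continuous_const Complex.continuous_re).inter ?_)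
    simp only [Set.ofPred_forall]
    exact isClosed_biInter fun w _ => isClosed_le continuous_const (by fun_prop)
  -- A point of `K` at height `1` would lie in the closure of the arc, hence closer to it than `ε`.
  have hpos : ∀ s ∈ K, 0 < |szegoHeight s - 1| := fun s ⟨h1, h0, h2⟩ => by
    rw [abs_pos, sub_ne_zero]
    intro h
    obtain ⟨w, hw, hd⟩ := Metric.mem_closure_iff.1 (mem_closure_szegoArc h0 h1 h) ε hε
    rw [dist_eq_norm] at hd
    exact (h2 w hw).not_gt hd
  obtain ⟨η, hη, hle⟩ := hKc.exists_forall_le'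
    (f := fun s => |szegoHeight s - 1|)
    ((continuous_szegoHeight.sub continuous_const).abs.continuousOn) hpos
  refine ⟨min η (1 / 100), by positivity, min_le_right _ _, fun s h0 h1 h2 => ?_⟩
  have h3 := (min_le_left η (1 / 100)).trans (hle s ⟨h1, h0, h2⟩)
  rcases le_abs'.1 h3 with h | h
  · left; linarith
  · right; linarith

lemma exp_mul_re_le {n : ℕ} (hn : 1 ≤ n) {s : ℂ} {r : ℝ} (hr : 0 < r) (hs : r ≤ szegoHeight s) :
    Real.exp (n * s.re) ≤ 8 * √n * r⁻¹ ^ n * ‖topTerm n s‖ := by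
  have h1 := le_norm_topTerm hn s
  rw [← szegoHeight_mul_exp, mul_pow, ← Real.exp_nat_mul] at h1
  have h2 : r ^ n * Real.exp (n * s.re) ≤ 8 * √n * ‖topTerm n s‖ := by
    refine le_trans ?_ h1
    gcongr
  rw [inv_pow, mul_right_comm, ← div_eq_mul_inv, le_div_iff₀ (by positivity), mul_comm]
  exact h2

lemma norm_topTerm_le_of_height {n : ℕ} {s : ℂ} {r : ℝ} (hs : szegoHeight s ≤ r) :
    ‖topTerm n s‖ ≤ r ^ n * Real.exp (n * s.re) := by
  refine (norm_topTerm_le n s).trans ?_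
  rw [← szegoHeight_mul_exp, mul_pow, ← Real.exp_nat_mul]
  have : 0 ≤ szegoHeight s := by unfold szegoHeight; positivity
  gcongr

lemma exp_half_lt : Real.exp (1 / 2) < 165 / 100 := by
  have h := Real.exp_one_lt_d9
  have h3 : Real.exp (1 / 2) ^ 2 = Real.exp 1 := by rw [← Real.exp_nat_mul]; norm_num
  nlinarith [Real.exp_pos (1 / 2)]

/-- Points of height close to `1` stay away from the inner pole at `1 / 2` and from the origin. -/
lemma bounds_of_le_szegoHeight {s : ℂ} (h0 : 0 ≤ s.re) (hs : 99 / 100 ≤ szegoHeight s) :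
    36 / 100 ≤ ‖s‖ ∧ 2 / 100 ≤ ‖1 - 2 * s‖ := by
  constructor
  · have h1 : szegoHeight s ≤ ‖s‖ * Real.exp 1 := by
      unfold szegoHeight
      gcongr
      linarith
    have := Real.exp_one_lt_d9
    nlinarith [norm_nonneg s]
  · by_contra! h
    have h1 : ‖1 / 2 - s‖ < 1 / 100 := by
      have : (1 - 2 * s) = 2 * (1 / 2 - s) := by ring
      rw [this, norm_mul, RCLike.norm_ofNat] at h
      linarith
    have h2 : ‖s‖ ≤ 51 / 100 := by
      have := norm_sub_norm_le s (1 / 2)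
      rw [norm_sub_rev] at this
      have h' : ‖(1 / 2 : ℂ)‖ = 1 / 2 := by simp
      linarith
    have h3 : 1 / 2 - s.re ≤ 1 / 100 := by
      have := (Complex.re_le_norm (1 / 2 - s)).trans h1.le
      simpa using this
    have h4 : Real.exp (1 - s.re) ≤ 165 / 100 * (1 / (1 - 1 / 100)) := by
      calc _ ≤ Real.exp (1 / 2 + 1 / 100) := Real.exp_le_exp.2 (by linarith)
        _ ≤ _ := by
          rw [Real.exp_add]
          gcongr
          · exact exp_half_lt.le
          · exact Real.exp_bound_div_one_sub_of_interval (by norm_num) (by norm_num)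
    unfold szegoHeight at hs
    have : ‖s‖ * Real.exp (1 - s.re) ≤ 51 / 100 * (165 / 100 * (1 / (1 - 1 / 100))) := by gcongr
    norm_num at this
    linarith

lemma tendsto_sqrt_mul_pow {r : ℝ} (h0 : 0 ≤ r) (h1 : r < 1) :
    Tendsto (fun n : ℕ => √n * r ^ n) atTop (𝓝 0) := by
  have h := tendsto_self_mul_const_pow_of_lt_one h0 h1
  refine squeeze_zero (fun n => by positivity) (fun n => ?_) h
  gcongr
  rcases n.eq_zero_or_pos with rfl | hn
  · simp
  · have : (1 : ℝ) ≤ n := by exact_mod_cast hn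
    exact Real.sqrt_le_iff.2 ⟨by positivity, by nlinarith⟩

lemma tendsto_const_div_sqrt (C : ℝ) : Tendsto (fun n : ℕ => C / √n) atTop (𝓝 0) :=
  tendsto_const_nhds.div_atTop (Real.tendsto_sqrt_atTop.comp tendsto_natCast_atTop_atTop)

lemma norm_topTerm_pos {n : ℕ} (hn : 1 ≤ n) {s : ℂ} (hs : s ≠ 0) : 0 < ‖topTerm n s‖ := by
  have : 0 < ‖s‖ := norm_pos_iff.2 hs
  have : (0 : ℝ) < n := by exact_mod_cast hn
  rw [norm_topTerm]; positivity

lemma norm_exp_natCast_mul (n : ℕ) (s : ℂ) : ‖Complex.exp (n * s)‖ = Real.exp (n * s.re) := by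
  rw [Complex.norm_exp, ← Complex.ofReal_natCast, Complex.re_ofReal_mul]

lemma norm_twoExp_le (n : ℕ) {s : ℂ} (hs : 0 ≤ s.re) :
    ‖twoExp n s‖ ≤ 2 * Real.exp (n * s.re) := by
  have h1 : Real.exp (n * (-s).re) ≤ Real.exp (n * s.re) := by
    apply Real.exp_le_exp.2
    have : (-s).re ≤ s.re := by rw [Complex.neg_re]; linarith
    gcongr
  calc _ ≤ ‖Complex.exp (n * s)‖ + ‖(-1 : ℂ) ^ n * Complex.exp (n * -s)‖ := norm_add_le _ _
    _ ≤ _ := by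
      rw [norm_mul, norm_pow, norm_neg, norm_one, one_pow, one_mul, norm_exp_natCast_mul,
        norm_exp_natCast_mul]
      linarith

/-- Outside the disc no exponential is present, and the error `C/√n` eventually drops below the
lower bound `e^(-6π)` for `bernGen`. -/
lemma eventually_bernSum_ne_zero_of_one_le {ε : ℝ} (hε : 0 < ε) : ∀ᶠ n : ℕ in atTop, ∀ s : ℂ,
    0 < s.re → 1 ≤ ‖s‖ → ε ≤ ‖s - 1‖ → bernSum n s ≠ 0 := by
  set δ := min (ε / 2) (1 / 2) with hδ
  have hδ0 : 0 < δ := by positivity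
  obtain ⟨C, hC, hb⟩ := exists_bernSum_sub_bound_of_one_le hδ0
  filter_upwards [eventually_ge_atTop 1, (tendsto_const_div_sqrt C).eventually_lt_const
    (Real.exp_pos (-(6 * Real.pi)))] with n hn hlt s hre hs hd hzero
  have hs0 : s ≠ 0 := norm_pos_iff.1 (by linarith)
  have hinv : ‖s⁻¹‖ ≤ 1 := by rw [norm_inv]; exact inv_le_one_of_one_le₀ hs
  have hre' : 0 < (s⁻¹).re := by
    rw [Complex.inv_re]
    exact div_pos hre (Complex.normSq_pos.2 hs0)
  have h1 : δ ≤ ‖1 - s⁻¹‖ := by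
    rcases le_total ‖s‖ 2 with h | h
    · refine (min_le_left _ _).trans ?_
      rw [show 1 - s⁻¹ = (s - 1) / s by field_simp, norm_div]
      have : 0 < ‖s‖ := by linarith
      gcongr
    · refine (min_le_right _ _).trans ?_
      have h2 := norm_sub_norm_le 1 s⁻¹
      have h3 : ‖s⁻¹‖ ≤ 2⁻¹ := by rw [norm_inv]; gcongr
      rw [norm_one] at h2
      linarith
  have h2 : δ ≤ ‖1 + s⁻¹‖ := by
    have h3 := Complex.re_le_norm (1 + s⁻¹)
    rw [Complex.add_re, Complex.one_re] at h3
    linarith [min_le_right (ε / 2) (1 / 2)]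
  have h3 := hb n hn s hs h1 h2
  rw [hzero, zero_sub, norm_neg, norm_mul, mul_comm] at h3
  have hpos := norm_topTerm_pos hn hs0
  have h4 : Real.exp (-(6 * Real.pi)) ≤ ‖bernGen s⁻¹‖ := by
    refine le_norm_bernGen (by linarith) (inv_ne_zero hs0) ?_ ?_ ?_ ?_
    · intro h; rw [h] at h1; simp at h1; linarith
    · intro h; rw [h] at hre'; simp at hre'; linarith
    · intro h; rw [h] at hinv; simp at hinv
    · intro h; rw [h] at hre'; simp at hre'; linarith
  have h5 := le_of_mul_le_mul_right h3 hpos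
  linarith

/-- Near the arc, and outside of it, the polynomial is the sum of two explicit terms. -/
lemma exists_bernSum_bound_near_arc {ε : ℝ} (hε : 0 < ε) : ∃ C : ℝ, 0 < C ∧
    ∀ n : ℕ, 1 ≤ n → ∀ s : ℂ, 0 < s.re → ‖s‖ ≤ 1 → ε ≤ ‖s - 1‖ → 995 / 1000 ≤ szegoHeight s →
      ‖bernSum n s + twoExp n s - topTerm n s * bernGen s⁻¹‖ ≤
        (C / √n + 16 * (√n * (990 / 995) ^ n)) * ‖topTerm n s‖ := by
  obtain ⟨C, hC, hb⟩ := exists_bernSum_sub_bound_of_le_one (ε := min ε (2 / 100)) (by positivity)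
  refine ⟨C, hC, fun n hn s hre hs hd hh => ?_⟩
  obtain ⟨h1, h2⟩ := bounds_of_le_szegoHeight hre.le (by linarith)
  have hplus : ∀ a : ℝ, 0 ≤ a → 1 ≤ ‖1 + (a : ℂ) * s‖ := fun a ha => by
    refine le_trans ?_ (Complex.re_le_norm _)
    simp only [Complex.add_re, Complex.one_re, Complex.re_ofReal_mul]
    nlinarith
  have h5 : min ε (2 / 100) ≤ 1 := (min_le_right _ _).trans (by norm_num)
  have h3 := hb n hn s h1 hs ((min_le_left _ _).trans (by rwa [norm_sub_rev]))
    (h5.trans (by simpa using hplus 1 (by norm_num))) ((min_le_right _ _).trans h2)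
    (h5.trans (by simpa using hplus 2 (by norm_num)))
  refine h3.trans ?_
  have h4 := exp_mul_re_le hn (by norm_num) hh
  rw [abs_of_pos hre, add_mul]
  refine add_le_add_right ?_ _
  -- Height at least `0.995` converts `e^(n Re s)` into the top term at a cost of `0.995^(-n)`,
  -- which `0.99^n` outweighs.
  calc 2 * ((99 / 100 : ℝ) ^ n * Real.exp (n * s.re))
      ≤ 2 * ((99 / 100 : ℝ) ^ n * (8 * √n * (995 / 1000 : ℝ)⁻¹ ^ n * ‖topTerm n s‖)) := by gcongr
    _ = 16 * (√n * ((99 / 100 : ℝ) ^ n * (995 / 1000 : ℝ)⁻¹ ^ n)) * ‖topTerm n s‖ := by ring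
    _ = _ := by rw [← mul_pow]; norm_num

lemma le_norm_bernGen_inv {s : ℂ} (hre : 0 < s.re) (h1 : s ≠ 1) (hh : 99 / 100 ≤ szegoHeight s) :
    Real.exp (-(6 * Real.pi)) ≤ ‖bernGen s⁻¹‖ := by
  obtain ⟨h2, h3⟩ := bounds_of_le_szegoHeight hre.le hh
  have hs0 : s ≠ 0 := norm_pos_iff.1 (by linarith)
  have hre' : 0 < (s⁻¹).re := by
    rw [Complex.inv_re]
    exact div_pos hre (Complex.normSq_pos.2 hs0)
  refine le_norm_bernGen ((norm_inv_le_of_le h2).trans_lt (by norm_num)) (inv_ne_zero hs0)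
    (by simpa using h1) ?_ ?_ ?_
  · intro h; rw [h] at hre'; simp at hre'; linarith
  · intro h
    rw [inv_eq_iff_eq_inv] at h
    rw [h] at h3; norm_num at h3
  · intro h; rw [h] at hre'; simp at hre'; linarith

/-- Here the exponentials are smaller than the top term by a factor `√n (1 + η)^(-n)`, up to a
constant. -/
lemma eventually_bernSum_ne_zero_of_height_ge {ε η : ℝ} (hε : 0 < ε) (hη : 0 < η) :
    ∀ᶠ n : ℕ in atTop, ∀ s : ℂ, 0 < s.re → ‖s‖ ≤ 1 → ε ≤ ‖s - 1‖ → 1 + η ≤ szegoHeight s →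
      bernSum n s ≠ 0 := by
  obtain ⟨C, hC, hb⟩ := exists_bernSum_bound_near_arc hε
  have hlim : Tendsto (fun n : ℕ => C / √n + 16 * (√n * (990 / 995 : ℝ) ^ n) +
      16 * (√n * ((1 + η)⁻¹) ^ n)) atTop (𝓝 (0 + 16 * 0 + 16 * 0)) :=
    ((tendsto_const_div_sqrt C).add ((tendsto_sqrt_mul_pow (by norm_num)
      (by norm_num)).const_mul 16)).add ((tendsto_sqrt_mul_pow (by positivity)
      (inv_lt_one_of_one_lt₀ (by linarith))).const_mul 16)
  filter_upwards [eventually_ge_atTop 1, hlim.eventually_lt_const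
    (by simpa using Real.exp_pos (-(6 * Real.pi)))] with n hn hlt s hre hs hd hh hzero
  have hs0 : s ≠ 0 := by rintro rfl; simp at hre
  have hne : s ≠ 1 := by rintro rfl; simp at hd; linarith
  have h1 := hb n hn s hre hs hd (by linarith)
  have h2 := (norm_twoExp_le n hre.le).trans (mul_le_mul_of_nonneg_left
    (exp_mul_re_le hn (by linarith) hh) zero_le_two)
  have h3 := le_norm_bernGen_inv hre hne (by linarith)
  have hpos := norm_topTerm_pos hn hs0
  rw [hzero, zero_add] at h1
  have h4 : ‖topTerm n s‖ * ‖bernGen s⁻¹‖ ≤ (C / √n + 16 * (√n * (990 / 995) ^ n) +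
      16 * (√n * ((1 + η)⁻¹) ^ n)) * ‖topTerm n s‖ := by
    rw [← norm_mul]
    have h5 := norm_sub_le (twoExp n s) (twoExp n s - topTerm n s * bernGen s⁻¹)
    rw [sub_sub_cancel] at h5
    linarith
  rw [mul_comm] at h4
  have h5 := le_of_mul_le_mul_right h4 hpos
  linarith

/-- The polynomial `B_n` has real coefficients, and `z ↦ conj z` becomes `s ↦ -conj s`. -/
lemma conj_bernSum (n : ℕ) (s : ℂ) :
    bernSum n (-(starRingEnd ℂ) s) = (-1) ^ n * (starRingEnd ℂ) (bernSum n s) := by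
  rw [bernSum, bernSum, map_sum, Finset.mul_sum]
  refine Finset.sum_congr rfl fun k hk => ?_
  have hk : k ≤ n := by simpa [Nat.lt_succ_iff] using hk
  have h1 : (starRingEnd ℂ) (bernCoeff k) = (-1) ^ k * bernCoeff k := by
    simp only [bernCoeff, map_div₀, map_mul, map_pow, Complex.conj_I, Complex.conj_ofReal,
      map_neg, map_ofNat, map_ratCast, map_natCast]
    rw [show -2 * (Real.pi : ℂ) * -Complex.I = (-1) * (-2 * Real.pi * Complex.I) by ring, mul_pow]
    ring
  have h2 : (-1 : ℂ) ^ n = (-1) ^ k * (-1) ^ (n - k) := by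
    rw [← pow_add, Nat.add_sub_cancel' hk]
  have h3 : (-1 : ℂ) ^ k * (-1) ^ k = 1 := by rw [← mul_pow]; norm_num
  rw [map_mul, h1, map_div₀, map_pow, map_mul, map_natCast, map_natCast, h2,
    show (n : ℂ) * -(starRingEnd ℂ) s = (-1) * (n * (starRingEnd ℂ) s) by ring, mul_pow (-1 : ℂ)]
  linear_combination -(bernCoeff k * (-1) ^ (n - k) * ((n * (starRingEnd ℂ) s) ^ (n - k) /
    ((n - k).factorial : ℂ))) * h3

lemma differentiable_bernSum (n : ℕ) : Differentiable ℂ (bernSum n) := by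
  unfold bernSum
  fun_prop

lemma differentiable_twoExp (n : ℕ) : Differentiable ℂ (twoExp n) := by
  unfold twoExp
  fun_prop

lemma differentiable_topTerm (n : ℕ) : Differentiable ℂ (topTerm n) := by
  unfold topTerm
  fun_prop

/-- If `bernSum` is close to its two-exponential approximation near the segment from `-conj s`
to `s`, then `s` and its mirror image cannot both be zeros. -/
lemma bernSum_ne_zero_of_approx {n : ℕ} (hn : 1 ≤ n) {s : ℂ} (hre : 0 < s.re) {h κ : ℝ}
    (hh : 0 < h) (hκ : κ / h + κ < 2)
    (hb : ∀ w : ℂ, ‖w‖ ≤ ‖s‖ + h → |w.re| ≤ s.re + h → ‖bernSum n w + twoExp n w‖ ≤ κ) :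
    bernSum n s ≠ 0 := by
  intro hzero
  have hn' : (1 : ℝ) ≤ n := by exact_mod_cast hn
  set r : ℂ → ℂ := fun w => bernSum n w + twoExp n w with hr
  have hdiff : Differentiable ℂ r := (differentiable_bernSum n).add (differentiable_twoExp n)
  set s' := -(starRingEnd ℂ) s with hs'
  have hzero' : bernSum n s' = 0 := by rw [hs', conj_bernSum, hzero]; simp
  have hrs : r s = twoExp n s := by simp [hr, hzero]
  have hrs' : r s' = twoExp n s' := by simp [hr, hzero']
  have hns' : ‖s'‖ = ‖s‖ := by simp [hs']
  have hres' : s'.re = -s.re := by simp [hs']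
  have hκ0 : 0 ≤ κ := (norm_nonneg _).trans (hb s (by linarith)
    (by rw [abs_of_pos hre]; linarith))
  set S : Set ℂ := Metric.closedBall 0 ‖s‖ ∩ {w | |w.re| ≤ s.re} with hS
  have hconv : Convex ℝ S := by
    refine (convex_closedBall _ _).inter ?_
    have : {w : ℂ | |w.re| ≤ s.re} = Complex.reLm ⁻¹' Set.Icc (-s.re) s.re := by
      ext w; simp [abs_le]
    rw [this]
    exact (convex_Icc _ _).is_linear_preimage Complex.reLm.isLinear
  have hd : ∀ w ∈ S, ‖deriv r w‖ ≤ κ / h := fun w ⟨hw1, hw2⟩ => by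
    refine Complex.norm_deriv_le_of_forall_mem_sphere_norm_le hh hdiff.diffContOnCl fun z hz => ?_
    have hz' : ‖z - w‖ = h := by simpa [dist_eq_norm] using hz
    rw [mem_closedBall_zero_iff] at hw1
    refine hb z ?_ ?_
    · have := norm_sub_norm_le z w; linarith
    · have h1 := (Complex.abs_re_le_norm (z - w)).trans hz'.le
      have h2 := abs_sub_abs_le_abs_sub z.re w.re
      rw [Complex.sub_re] at h1
      have h3 : |w.re| ≤ s.re := hw2
      linarith
  -- Cauchy's estimate makes `r` Lipschitz between `s'` and `s`. The resulting factor `2 Re s` is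
  -- what survives as `s` approaches the imaginary axis.
  have hlip : ‖r s - r s'‖ ≤ κ / h * ‖s - s'‖ :=
    hconv.norm_image_sub_le_of_norm_deriv_le (fun w _ => hdiff w) hd
      ⟨by simp [hns'], by simp [hres', abs_of_pos hre]⟩ ⟨by simp, by simp [abs_of_pos hre]⟩
  have hss : ‖s - s'‖ = 2 * s.re := by
    rw [hs', sub_neg_eq_add, Complex.add_conj, Complex.norm_real, Real.norm_of_nonneg (by linarith)]
  set X : ℂ := Complex.exp (n * (s.im * Complex.I)) with hX
  have hXn : ‖X‖ = 1 := by
    rw [hX, show (n : ℂ) * (s.im * Complex.I) = ((n * s.im : ℝ) : ℂ) * Complex.I by push_cast; ring]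
    exact Complex.norm_exp_ofReal_mul_I _
  have hX0 : X ≠ 0 := Complex.exp_ne_zero _
  set P : ℝ := Real.exp (n * s.re) with hP
  have hP0 : 0 < P := Real.exp_pos _
  have hsx : Complex.exp (n * s) = P * X := by
    rw [hX, hP, Complex.ofReal_exp, ← Complex.exp_add]
    congr 1
    conv_lhs => rw [← Complex.re_add_im s]
    push_cast; ring
  have hsx' : Complex.exp (n * s') = (P : ℂ)⁻¹ * X := by
    rw [hX, hP, Complex.ofReal_exp, ← Complex.exp_neg, ← Complex.exp_add]
    congr 1
    conv_lhs => rw [← Complex.re_add_im s']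
    have : s'.im = s.im := by simp [hs']
    rw [hres', this]
    push_cast; ring
  have ht : twoExp n s = P * X + (-1) ^ n * ((P : ℂ)⁻¹ * X⁻¹) := by
    rw [twoExp, mul_neg, Complex.exp_neg, hsx, mul_inv]
  have ht' : twoExp n s' = (P : ℂ)⁻¹ * X + (-1) ^ n * (P * X⁻¹) := by
    rw [twoExp, mul_neg _ s', Complex.exp_neg, hsx', mul_inv, inv_inv]
  have hb1 := hb s (by linarith) (by rw [abs_of_pos hre]; linarith)
  have hb2 := hb s' (by linarith) (by rw [hres', abs_neg, abs_of_pos hre]; linarith)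
  change ‖r s‖ ≤ κ at hb1
  change ‖r s'‖ ≤ κ at hb2
  -- At the two zeros `r` equals `twoExp`. The sum and the difference of its values isolate `X ±
  -- (-1)^n X⁻¹`, with factors `P + P⁻¹ ≥ 2` and `P - P⁻¹ = 2 sinh(n Re s) ≥ 2 Re s`. Both
  -- quantities are then small, although they add up to `2X` with `‖X‖ = 1`.
  have hsum : (P + P⁻¹) * ‖X + (-1) ^ n * X⁻¹‖ ≤ 2 * κ := by
    have e : r s + r s' = ((P + P⁻¹ : ℝ) : ℂ) * (X + (-1) ^ n * X⁻¹) := by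
      rw [hrs, hrs', ht, ht']; push_cast; ring
    have h1 := (norm_add_le (r s) (r s')).trans (add_le_add hb1 hb2)
    rw [e, norm_mul, Complex.norm_real, Real.norm_of_nonneg (by positivity)] at h1
    linarith
  have hPinv : P - P⁻¹ = 2 * Real.sinh (n * s.re) := by
    rw [Real.sinh_eq, hP, ← Real.exp_neg]; ring
  have hsinh : n * s.re ≤ Real.sinh (n * s.re) := Real.self_le_sinh_iff.2 (by positivity)
  have hdif : (P - P⁻¹) * ‖X - (-1) ^ n * X⁻¹‖ ≤ κ / h * (2 * s.re) := by
    have e : r s - r s' = ((P - P⁻¹ : ℝ) : ℂ) * (X - (-1) ^ n * X⁻¹) := by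
      rw [hrs, hrs', ht, ht']; push_cast; ring
    rw [e, norm_mul, Complex.norm_real, hss, Real.norm_of_nonneg (by
      rw [hPinv]; have : 0 ≤ n * s.re := by positivity
      linarith)] at hlip
    exact hlip
  have h1 : ‖X - (-1) ^ n * X⁻¹‖ ≤ κ / h := by
    have h2 : 2 * s.re ≤ P - P⁻¹ := by
      rw [hPinv]; nlinarith
    have h3 : 2 * s.re * ‖X - (-1) ^ n * X⁻¹‖ ≤ 2 * s.re * (κ / h) := by
      calc _ ≤ (P - P⁻¹) * ‖X - (-1) ^ n * X⁻¹‖ := by gcongr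
        _ ≤ _ := by linarith
    exact le_of_mul_le_mul_left h3 (by linarith)
  have h2 : ‖X + (-1) ^ n * X⁻¹‖ ≤ κ := by
    have h3 : 2 ≤ P + P⁻¹ := by
      have : P + P⁻¹ - 2 = (P - 1) ^ 2 * P⁻¹ := by field_simp; ring
      have h4 : 0 ≤ (P - 1) ^ 2 * P⁻¹ := by positivity
      linarith
    nlinarith [norm_nonneg (X + (-1) ^ n * X⁻¹)]
  have h3 : ‖(2 : ℂ) * X‖ ≤ κ / h + κ := by
    rw [show 2 * X = (X - (-1) ^ n * X⁻¹) + (X + (-1) ^ n * X⁻¹) by ring]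
    exact (norm_add_le _ _).trans (add_le_add h1 h2)
  rw [norm_mul, hXn, RCLike.norm_ofNat] at h3
  linarith

/-- For `Re s ≥ η/16` the term `e^(ns)` alone dominates. Nearer the imaginary axis `e^(-ns)` is
comparable and the mirror argument takes over. -/
lemma eventually_bernSum_ne_zero_of_height_le {η : ℝ} (hη : 0 < η) (hη1 : η ≤ 1 / 100) :
    ∀ᶠ n : ℕ in atTop, ∀ s : ℂ, 0 < s.re → ‖s‖ ≤ 1 → szegoHeight s ≤ 1 - η →
      bernSum n s ≠ 0 := by
  obtain ⟨C, hC, hb⟩ := exists_bernSum_add_twoExp_bound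
  -- `ρ` bounds `1 - η`, `0.99 e^(η/8)`, and `e‖w‖` for `w` as in the mirror argument with `h =
  -- η/16`. `θ` bounds `e^(-2 Re s)` once `Re s ≥ η/16`.
  set ρ : ℝ := 1 - η / 4 with hρ
  set θ : ℝ := Real.exp (-(η / 8)) with hθ
  have hθ1 : θ < 1 := by rw [hθ, Real.exp_lt_one_iff]; linarith
  have hexp : Real.exp (η / 8) ≤ 1 / (1 - η / 8) :=
    Real.exp_bound_div_one_sub_of_interval (by positivity) (by linarith)
  have hexp' : Real.exp (η / 8) * (99 / 100) ≤ ρ := by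
    refine (mul_le_mul_of_nonneg_right hexp (by norm_num)).trans ?_
    rw [one_div, ← div_eq_inv_mul, div_le_iff₀ (by linarith), hρ]
    nlinarith
  have hlim : Tendsto (fun n : ℕ => 2 * C * (√n * ρ ^ n)) atTop (𝓝 (2 * C * 0)) :=
    (tendsto_sqrt_mul_pow (by linarith) (by linarith)).const_mul _
  rw [mul_zero] at hlim
  have hlim2 : Tendsto (fun n : ℕ => 2 * C * (√n * ρ ^ n) + θ ^ n) atTop (𝓝 (0 + 0)) :=
    hlim.add (tendsto_pow_atTop_nhds_zero_of_lt_one (Real.exp_pos _).le hθ1)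
  have hlim3 : Tendsto (fun n : ℕ => 2 * C * (√n * ρ ^ n) / (η / 16) + 2 * C * (√n * ρ ^ n))
      atTop (𝓝 (0 / (η / 16) + 0)) := (hlim.div_const _).add hlim
  filter_upwards [eventually_ge_atTop 1, hlim2.eventually_lt_const (u := 1) (by norm_num),
    hlim3.eventually_lt_const (u := 2) (by norm_num)] with n hn hlt2 hlt3 s hre hs hh
  have hs1 : 1 ≤ √(n : ℝ) := Real.one_le_sqrt.2 (by exact_mod_cast hn)
  rcases le_total (η / 16) s.re with hbig | hsmall
  · intro hzero
    have h1 := hb n hn s hs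
    rw [hzero, zero_add, abs_of_pos hre] at h1
    have h2 := norm_topTerm_le_of_height (n := n) hh
    set E := Real.exp (n * s.re) with hE
    have hE0 : 0 < E := Real.exp_pos _
    have h3 : ‖twoExp n s‖ ≤ 2 * C * (√n * ρ ^ n) * E := by
      have e1 : (1 - η) ^ n ≤ ρ ^ n := pow_le_pow_left₀ (by linarith) (by linarith) n
      have e2 : (99 / 100 : ℝ) ^ n ≤ ρ ^ n := pow_le_pow_left₀ (by linarith) (by linarith) n
      have e3 : 0 ≤ ρ ^ n := pow_nonneg (by linarith) n
      calc _ ≤ C * (√n * ‖topTerm n s‖ + (99 / 100) ^ n * E) := h1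
        _ ≤ C * (√n * (ρ ^ n * E) + √n * (ρ ^ n * E)) := by
            refine mul_le_mul_of_nonneg_left (add_le_add ?_ ?_) hC.le
            · exact mul_le_mul_of_nonneg_left (h2.trans (by gcongr)) (by positivity)
            · calc _ ≤ 1 * (ρ ^ n * E) := by rw [one_mul]; gcongr
                _ ≤ _ := by gcongr
        _ = _ := by ring
    have h4 : E * (1 - θ ^ n) ≤ ‖twoExp n s‖ := by
      have e1 := norm_sub_norm_le (Complex.exp (n * s)) (-((-1) ^ n * Complex.exp (n * -s)))
      rw [sub_neg_eq_add, norm_neg, norm_mul, norm_pow, norm_neg, norm_one, one_pow, one_mul,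
        norm_exp_natCast_mul, norm_exp_natCast_mul] at e1
      have e2 : Real.exp (n * (-s).re) ≤ E * θ ^ n := by
        rw [hE, hθ, ← Real.exp_nat_mul, ← Real.exp_add, Complex.neg_re]
        apply Real.exp_le_exp.2
        have : (0 : ℝ) ≤ n := n.cast_nonneg
        nlinarith
      change _ ≤ ‖twoExp n s‖ at e1
      linarith
    have h5 : E * (1 - θ ^ n) ≤ E * (2 * C * (√n * ρ ^ n)) := by linarith
    have := le_of_mul_le_mul_left h5 hE0
    linarith
  · refine bernSum_ne_zero_of_approx hn hre (h := η / 16) (by positivity) hlt3 fun w hw hwre => ?_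
    have hse : Real.exp 1 * ‖s‖ ≤ 1 - η / 2 := by
      rw [← szegoHeight_mul_exp]
      have e1 : Real.exp s.re ≤ 1 / (1 - s.re) :=
        Real.exp_bound_div_one_sub_of_interval hre.le (by linarith)
      calc _ ≤ (1 - η) * (1 / (1 - s.re)) := by
            have : 0 ≤ 1 - η := by linarith
            gcongr
        _ ≤ _ := by
            rw [mul_one_div, div_le_iff₀ (by linarith)]
            nlinarith
    have he := Real.exp_one_lt_d9
    have he' := Real.exp_one_gt_d9
    have hwe : Real.exp 1 * ‖w‖ ≤ ρ := by
      calc _ ≤ Real.exp 1 * (‖s‖ + η / 16) := by gcongr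
        _ ≤ _ := by rw [hρ]; nlinarith
    have hw1 : ‖w‖ ≤ 1 := by nlinarith [norm_nonneg w]
    have h1 := (norm_topTerm_le n w).trans (pow_le_pow_left₀ (by positivity) hwe n)
    have h2 : (99 / 100 : ℝ) ^ n * Real.exp (n * |w.re|) ≤ ρ ^ n := by
      rw [Real.exp_nat_mul, ← mul_pow]
      refine pow_le_pow_left₀ (by positivity) ?_ n
      refine le_trans ?_ hexp'
      rw [mul_comm]
      gcongr
      linarith
    have e3 : 0 ≤ ρ ^ n := pow_nonneg (by linarith) n
    calc _ ≤ C * (√n * ‖topTerm n w‖ + (99 / 100) ^ n * Real.exp (n * |w.re|)) := hb n hn w hw1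
      _ ≤ C * (√n * ρ ^ n + √n * ρ ^ n) := by
          refine mul_le_mul_of_nonneg_left (add_le_add (by gcongr) (h2.trans ?_)) hC.le
          exact le_mul_of_one_le_left e3 hs1
      _ = _ := by ring

/-- All zeros in the right half plane are eventually close to the arc. -/
theorem eventually_zeros_near_szegoArc {ε : ℝ} (hε : 0 < ε) : ∀ᶠ n : ℕ in atTop, ∀ s : ℂ,
    0 < s.re → bernSum n s = 0 → ∃ w ∈ szegoArc, ‖s - w‖ < ε := by
  obtain ⟨η, hη, hη1, hgap⟩ := exists_szegoHeight_gap hε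
  filter_upwards [eventually_bernSum_ne_zero_of_one_le hε,
    eventually_bernSum_ne_zero_of_height_ge hε hη,
    eventually_bernSum_ne_zero_of_height_le hη hη1] with n h1 h2 h3 s hre hzero
  by_contra! hfar
  have hone := hfar 1 one_mem_szegoArc
  rcases le_total 1 ‖s‖ with h | h
  · exact h1 s hre h hone hzero
  · rcases hgap s hre.le h hfar with h' | h'
    · exact h3 s hre h h' hzero
    · exact h2 s hre h hone h' hzero

end

/-! ### Zeros near each point of the arc -/

section

open Filter Topology Metric

/-- A quantitative open mapping theorem, stable under perturbation: an error of at most `c/8` leaves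
variation at least `c/2` on the sphere, so the image of the closed disc contains the ball of radius
`c/4`. -/
lemma exists_add_eq_of_sphere_bound {L E : ℂ → ℂ} {p y : ℂ} {d d₀ c : ℝ} (hd : 0 < d)
    (hdd : d < d₀) (hc : 0 < c) (hL : DifferentiableOn ℂ L (ball p d₀))
    (hE : DifferentiableOn ℂ E (ball p d₀)) (hsph : ∀ z ∈ sphere p d, c ≤ ‖L z - L p‖)
    (hEb : ∀ z ∈ ball p d₀, ‖E z‖ ≤ c / 8) (hy : ‖y - (L p + E p)‖ < c / 4) :
    ∃ z ∈ closedBall p d, L z + E z = y := by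
  set F : ℂ → ℂ := fun z => L z + E z with hF
  have hFd : DifferentiableOn ℂ F (ball p d₀) := hL.add hE
  have hsub : closedBall p d ⊆ ball p d₀ := closedBall_subset_ball hdd
  have hp : p ∈ ball p d₀ := mem_ball_self (hd.trans hdd)
  have hbound : ∀ z ∈ sphere p d, c / 2 ≤ ‖F z - F p‖ := fun z hz => by
    have h1 := hsph z hz
    have h2 := hEb z (hsub (sphere_subset_closedBall hz))
    have h3 := hEb p hp
    have h4 : L z - L p = (F z - F p) - (E z - E p) := by simp only [hF]; ring
    have h5 := norm_sub_le (F z - F p) (E z - E p)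
    have h6 := norm_sub_le (E z) (E p)
    rw [← h4] at h5
    linarith
  have hfreq : ∃ᶠ z in 𝓝 p, F z ≠ F p := by
    intro h
    simp only [not_not] at h
    have heq := (hFd.analyticOnNhd isOpen_ball).eqOn_of_preconnected_of_eventuallyEq
      analyticOnNhd_const (convex_ball p d₀).isPreconnected hp h
    obtain ⟨z, hz⟩ : (sphere p d).Nonempty := NormedSpace.sphere_nonempty.2 hd.le
    have h1 := hbound z hz
    rw [heq (hsub (sphere_subset_closedBall hz)), sub_self, norm_zero] at h1
    linarith
  have hdiff : DiffContOnCl ℂ F (ball p d) :=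
    (hFd.mono (closure_ball_subset_closedBall.trans hsub)).diffContOnCl
  have himg := hdiff.ball_subset_image_closedBall hd hbound hfreq
  obtain ⟨z, hz, hzy⟩ := himg (show y ∈ ball (F p) (c / 2 / 2) by
    rw [mem_ball, dist_eq_norm]; linarith)
  exact ⟨z, hz, hzy⟩

lemma exists_int_near (x : ℝ) {n : ℕ} (hn : 1 ≤ n) :
    ∃ k : ℤ, |2 * Real.pi * k / n - x| ≤ Real.pi / n := by
  have hn' : (0 : ℝ) < n := by exact_mod_cast hn
  have hpi := Real.pi_pos
  refine ⟨round (x * n / (2 * Real.pi)), ?_⟩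
  have h := abs_sub_round (x * n / (2 * Real.pi))
  have e : 2 * Real.pi * (round (x * n / (2 * Real.pi)) : ℝ) / n - x =
      -(2 * Real.pi / n) * (x * n / (2 * Real.pi) - round (x * n / (2 * Real.pi))) := by
    field_simp
    ring
  rw [e, abs_mul, abs_neg, abs_of_pos (by positivity)]
  calc _ ≤ 2 * Real.pi / n * (1 / 2) := by gcongr
    _ = _ := by ring

/-- This closed form gives continuity of `bernGen s⁻¹`. The height condition keeps `‖s⁻¹‖ < 3` and
`s⁻¹ ≠ 2`. -/
lemma bernGen_inv_eq {s : ℂ} (hre : 0 < s.re) (h1 : s ≠ 1) (hh : 99 / 100 ≤ szegoHeight s) :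
    Complex.exp (-2 * Real.pi * Complex.I * s⁻¹) - 1 ≠ 0 ∧
    bernGen s⁻¹ = (-2 * Real.pi * Complex.I * s⁻¹) /
      (Complex.exp (-2 * Real.pi * Complex.I * s⁻¹) - 1) := by
  obtain ⟨h2, h3⟩ := bounds_of_le_szegoHeight hre.le hh
  have hs0 : s ≠ 0 := norm_pos_iff.1 (by linarith)
  have hre' : 0 < (s⁻¹).re := by
    rw [Complex.inv_re]
    exact div_pos hre (Complex.normSq_pos.2 hs0)
  have h := bernGen_mul ((norm_inv_le_of_le h2).trans_lt (by norm_num)) (inv_ne_zero hs0)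
    (by simpa using h1) (by intro h; rw [h] at hre'; simp at hre'; linarith)
    (by
      intro h
      rw [inv_eq_iff_eq_inv] at h
      rw [h] at h3; norm_num at h3)
    (by intro h; rw [h] at hre'; simp at hre'; linarith)
  have hne : Complex.exp (-2 * Real.pi * Complex.I * s⁻¹) - 1 ≠ 0 := by
    intro h0
    rw [h0, mul_zero] at h
    have hpi := Real.pi_ne_zero
    simp [hpi, hs0] at h
  exact ⟨hne, by rw [eq_div_iff hne, h]⟩

lemma continuousAt_bernGen_inv {p : ℂ} (hre : 0 < p.re) (h1 : p ≠ 1)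
    (hh : 99 / 100 < szegoHeight p) : ContinuousAt (fun s => bernGen s⁻¹) p := by
  have hp0 : p ≠ 0 := by rintro rfl; simp at hre
  have hev : ∀ᶠ s in 𝓝 p, 0 < s.re ∧ s ≠ 1 ∧ 99 / 100 < szegoHeight s :=
    (Complex.continuous_re.continuousAt.eventually_const_lt hre).and
      ((eventually_ne_nhds h1).and (continuous_szegoHeight.continuousAt.eventually_const_lt hh))
  have hcont : ContinuousAt (fun s : ℂ => (-2 * Real.pi * Complex.I * s⁻¹) /
      (Complex.exp (-2 * Real.pi * Complex.I * s⁻¹) - 1)) p := by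
    have hinv : ContinuousAt (fun s : ℂ => -2 * Real.pi * Complex.I * s⁻¹) p :=
      continuousAt_const.mul (continuousAt_inv₀ hp0)
    exact hinv.div (hinv.cexp.sub continuousAt_const) (bernGen_inv_eq hre h1 hh.le).1
  refine hcont.congr ?_
  filter_upwards [hev] with s ⟨h2, h3, h4⟩
  exact (bernGen_inv_eq h2 h3 h4.le).2.symm

/-- The normalising constants grow like `e ^ n`. -/
lemma tendsto_log_coeff_div {τ : ℂ} (hτ : τ ≠ 0) :
    Tendsto (fun n : ℕ => (Complex.log (((n : ℝ) ^ n / (n.factorial : ℝ) : ℝ) * τ)).re / n) atTop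
      (𝓝 1) := by
  have hlow : Tendsto (fun n : ℕ => 1 - 8 / √n + Real.log ‖τ‖ / n) atTop (𝓝 (1 - 0 + 0)) :=
    (tendsto_const_nhds.sub (tendsto_const_div_sqrt 8)).add
      (tendsto_const_nhds.div_atTop tendsto_natCast_atTop_atTop)
  have hup : Tendsto (fun n : ℕ => 1 + Real.log ‖τ‖ / n) atTop (𝓝 (1 + 0)) :=
    tendsto_const_nhds.add (tendsto_const_nhds.div_atTop tendsto_natCast_atTop_atTop)
  simp only [sub_zero, add_zero] at hlow hup
  have hre : ∀ n : ℕ, 1 ≤ n → (Complex.log (((n : ℝ) ^ n / (n.factorial : ℝ) : ℝ) * τ)).re =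
      Real.log ((n : ℝ) ^ n / (n.factorial : ℝ)) + Real.log ‖τ‖ := fun n hn => by
    have : (0 : ℝ) < n := by exact_mod_cast hn
    rw [Complex.log_re, norm_mul, Complex.norm_real, Real.norm_of_nonneg (by positivity),
      Real.log_mul (by positivity) (norm_ne_zero_iff.2 hτ)]
  refine tendsto_of_tendsto_of_tendsto_of_le_of_le' hlow hup ?_ ?_
  · filter_upwards [eventually_ge_atTop 1] with n hn
    have hn' : (0 : ℝ) < n := by exact_mod_cast hn
    have hs : 0 < √(n : ℝ) := Real.sqrt_pos.2 hn'
    have hs2 : √(n : ℝ) * √n = n := Real.mul_self_sqrt hn'.le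
    have h1 := Real.log_le_log (by positivity) (exp_pow_le hn)
    rw [Real.log_pow, Real.log_exp, Real.log_mul (by positivity) (by positivity)] at h1
    have h2 := Real.log_le_sub_one_of_pos (show 0 < 8 * √(n : ℝ) by positivity)
    have e : 1 - 8 / √(n : ℝ) + Real.log ‖τ‖ / n = (n - 8 * √n + Real.log ‖τ‖) / n := by
      have : 8 / √(n : ℝ) = 8 * √n / n := by
        rw [div_eq_div_iff hs.ne' hn'.ne']; linear_combination -8 * hs2
      rw [this]; field_simp
    rw [hre n hn, e]
    gcongr
    linarith
  · filter_upwards [eventually_ge_atTop 1] with n hn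
    have hn' : (0 : ℝ) < n := by exact_mod_cast hn
    have h1 := Real.log_le_log (by positivity) (pow_self_div_factorial_le n)
    rw [Real.log_pow, Real.log_exp, mul_one] at h1
    have e : 1 + Real.log ‖τ‖ / n = (n + Real.log ‖τ‖) / n := by field_simp
    rw [hre n hn, e]
    gcongr

/-- On the unit circle the arc equation forces `Re p = 1`, hence `p = 1`. -/
lemma norm_lt_one_of_mem_szegoArc {p : ℂ} (hp : p ∈ szegoArc) (h1 : p ≠ 1) : ‖p‖ < 1 := by
  refine lt_of_le_of_ne hp.2.1 fun h => h1 ?_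
  have h2 := hp.2.2
  rw [h, mul_one, Real.exp_eq_exp] at h2
  have h3 := Complex.sq_norm p
  rw [h, Complex.normSq_apply, h2] at h3
  have h4 : p.im = 0 := by nlinarith [sq_nonneg p.im]
  exact Complex.ext h2 h4

lemma norm_div_sub_one_le {a b : ℂ} (ha : ‖a - 1‖ ≤ 3 / 8) (hb : ‖b - 1‖ ≤ 1 / 20) :
    ‖a / b - 1‖ ≤ 1 / 2 := by
  have h1 : 19 / 20 ≤ ‖b‖ := by
    have := norm_sub_norm_le 1 b
    rw [norm_one, norm_sub_rev] at this
    linarith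
  have hb0 : b ≠ 0 := norm_pos_iff.1 (by linarith)
  rw [show a / b - 1 = ((a - 1) - (b - 1)) / b by field_simp; ring, norm_div,
    div_le_iff₀ (by linarith)]
  linarith [norm_sub_le (a - 1) (b - 1)]

lemma slitPlane_of_norm_sub_one_le {w : ℂ} (h : ‖w - 1‖ ≤ 1 / 2) : w ∈ Complex.slitPlane := by
  left
  have h1 := (Complex.abs_re_le_norm (w - 1)).trans h
  rw [Complex.sub_re, Complex.one_re, abs_le] at h1
  linarith

lemma norm_log_le_of_norm_sub_one_le {w : ℂ} (h : ‖w - 1‖ ≤ 1 / 2) : ‖Complex.log w‖ ≤ 1 := by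
  have h1 := Complex.norm_log_one_add_half_le_self h
  rw [add_sub_cancel] at h1
  linarith

/-- Every point of the arc other than its tip is a limit of zeros. -/
theorem eventually_exists_zero_near {p : ℂ} (hp : p ∈ szegoArc) (hp1 : p ≠ 1) {ε : ℝ}
    (hε : 0 < ε) : ∀ᶠ n : ℕ in atTop, ∃ s : ℂ, bernSum n s = 0 ∧ 0 < s.re ∧ ‖s - p‖ < ε := by
  have hre := hp.1
  have hheight : szegoHeight p = 1 := (szegoHeight_eq_one_iff p).2 hp.2.2
  have hp0 : p ≠ 0 := by rintro rfl; simp at hre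
  set τ : ℂ := bernGen p⁻¹ with hτ
  have hτ0 : τ ≠ 0 := norm_pos_iff.1 ((Real.exp_pos _).trans_le
    (le_norm_bernGen_inv hre hp1 (by rw [hheight]; norm_num)))
  have hτpos : 0 < ‖τ‖ := norm_pos_iff.2 hτ0
  set L : ℂ → ℂ := fun s => Complex.log s - s with hL
  -- a disc on which everything is under control
  have hgood : ∀ᶠ s in 𝓝 p, (p.re / 2 < s.re ∧ ‖s‖ < 1 ∧ ‖p - 1‖ / 2 < ‖s - 1‖ ∧
      995 / 1000 < szegoHeight s) ∧ ‖bernGen s⁻¹ - τ‖ < ‖τ‖ / 4 ∧ (s ≠ p → L s ≠ L p) := by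
    have hpn : 0 < ‖p - 1‖ := norm_pos_iff.2 (sub_ne_zero.2 hp1)
    have hc := (((continuousAt_bernGen_inv hre hp1 (by rw [hheight]; norm_num)).sub
      (continuousAt_const (y := τ))).norm).eventually_lt_const (u := ‖τ‖ / 4)
      (by simp [hτ] at hτpos ⊢; exact hτpos)
    -- `p ≠ 1` makes the derivative of `L` nonzero, so `L` avoids the value `L p` on a punctured
    -- neighbourhood.
    have hd : HasDerivAt L (p⁻¹ - 1) p :=
      (Complex.hasDerivAt_log (Or.inl hre)).sub (hasDerivAt_id p)
    have hne : p⁻¹ - 1 ≠ 0 := sub_ne_zero.2 (by simpa using hp1)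
    refine Eventually.and ?_ (hc.and (eventually_nhdsWithin_iff.1 (hd.eventually_ne hne)))
    exact (Complex.continuous_re.continuousAt.eventually_const_lt (half_lt_self hre)).and
      ((continuous_norm.continuousAt.eventually_lt_const
        (norm_lt_one_of_mem_szegoArc hp hp1)).and
      (((continuous_id.sub continuous_const).norm.continuousAt.eventually_const_lt
        (by simpa using half_lt_self hpn)).and
      (continuous_szegoHeight.continuousAt.eventually_const_lt (by rw [hheight]; norm_num))))
  obtain ⟨d₀, hd₀, hball⟩ := Metric.eventually_nhds_iff_ball.1 hgood
  set d := min (d₀ / 2) (ε / 2) with hd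
  have hdpos : 0 < d := by positivity
  have hdd : d < d₀ := (min_le_left _ _).trans_lt (half_lt_self hd₀)
  have hLdiff : DifferentiableOn ℂ L (ball p d₀) := fun s hs => by
    have h1 := (hball s hs).1.1
    exact ((Complex.hasDerivAt_log (Or.inl ((half_pos hre).trans h1))).differentiableAt.sub
      differentiableAt_id).differentiableWithinAt
  obtain ⟨c, hc, hsph⟩ : ∃ c : ℝ, 0 < c ∧ ∀ z ∈ sphere p d, c ≤ ‖L z - L p‖ := by
    have hsub : sphere p d ⊆ ball p d₀ :=
      sphere_subset_closedBall.trans (closedBall_subset_ball hdd)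
    exact (isCompact_sphere p d).exists_forall_le' (f := fun z => ‖L z - L p‖)
      ((hLdiff.continuousOn.mono hsub).sub continuousOn_const).norm fun z hz => by
        rw [norm_pos_iff, sub_ne_zero]
        exact (hball z (hsub hz)).2.2 (ne_of_mem_sphere hz hdpos.ne')
  obtain ⟨C, hC, hb⟩ := exists_bernSum_bound_near_arc (ε := ‖p - 1‖ / 2)
    (half_pos (norm_pos_iff.2 (sub_ne_zero.2 hp1)))
  set a : ℕ → ℂ := fun n => Complex.log (((n : ℝ) ^ n / (n.factorial : ℝ) : ℝ) * τ) with ha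
  have hlim1 : Tendsto (fun n : ℕ => C / √n + 16 * (√n * (990 / 995 : ℝ) ^ n)) atTop
      (𝓝 (0 + 16 * 0)) := (tendsto_const_div_sqrt C).add
        ((tendsto_sqrt_mul_pow (by norm_num) (by norm_num)).const_mul 16)
  have hlim2 : Tendsto (fun n : ℕ => Real.exp (-p.re) ^ n) atTop (𝓝 0) :=
    tendsto_pow_atTop_nhds_zero_of_lt_one (Real.exp_pos _).le
      (Real.exp_lt_one_iff.2 (by linarith))
  have hlim3 : Tendsto (fun n : ℕ => (1 : ℝ) / n) atTop (𝓝 0) :=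
    tendsto_const_nhds.div_atTop tendsto_natCast_atTop_atTop
  have hlim4 : Tendsto (fun n : ℕ => |(a n).re / n - 1| + (Real.pi + 1) / n) atTop
      (𝓝 (|1 - 1| + 0)) := ((tendsto_log_coeff_div hτ0).sub_const 1).abs.add
        (tendsto_const_nhds.div_atTop tendsto_natCast_atTop_atTop)
  filter_upwards [eventually_ge_atTop 1,
    hlim1.eventually_lt_const (u := ‖τ‖ / 8) (by simpa using hτpos),
    hlim2.eventually_lt_const (u := 1 / 20) (by norm_num),
    hlim3.eventually_lt_const (u := c / 8) (by positivity),
    hlim4.eventually_lt_const (u := c / 4) (by simpa using hc)] with n hn hn1 hn2 hn3 hn4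
  have hn' : (0 : ℝ) < n := by exact_mod_cast hn
  have hnC : (n : ℂ) ≠ 0 := by exact_mod_cast hn'.ne'
  -- Both `U` and `V` are near `1`. As `bernSum = 0` means `topTerm · τ · U = e^(ns) · V`, its
  -- logarithm over `n` reads `L + E + a n / n ∈ (2πi/n)ℤ`, with `‖E‖ ≤ 1/n`.
  set U : ℂ → ℂ := fun s => (bernSum n s + twoExp n s) / topTerm n s / τ with hU
  set V : ℂ → ℂ := fun s => twoExp n s / Complex.exp (n * s) with hV
  set E : ℂ → ℂ := fun s => Complex.log (U s / V s) / n with hE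
  have hs0 : ∀ s ∈ ball p d₀, s ≠ 0 ∧ topTerm n s ≠ 0 := fun s hs => by
    have h1 := (hball s hs).1.1
    have h2 : s ≠ 0 := by rintro rfl; simp at h1; linarith
    exact ⟨h2, norm_pos_iff.1 (norm_topTerm_pos hn h2)⟩
  have hUb : ∀ s ∈ ball p d₀, ‖U s - 1‖ ≤ 3 / 8 := fun s hs => by
    obtain ⟨⟨h1, h2, h3, h4⟩, h5, -⟩ := hball s hs
    have ht := (hs0 s hs).2
    have h6 := hb n hn s ((half_pos hre).trans h1) h2.le h3.le h4.le
    have h7 : ‖(bernSum n s + twoExp n s) / topTerm n s - bernGen s⁻¹‖ ≤ ‖τ‖ / 8 := by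
      rw [div_sub' ht, norm_div, div_le_iff₀ (norm_pos_iff.2 ht)]
      exact h6.trans (by gcongr)
    have e : U s - 1 = (((bernSum n s + twoExp n s) / topTerm n s - bernGen s⁻¹) +
        (bernGen s⁻¹ - τ)) / τ := by
      simp only [hU]; field_simp; ring
    rw [e, norm_div, div_le_iff₀ hτpos]
    linarith [norm_add_le ((bernSum n s + twoExp n s) / topTerm n s - bernGen s⁻¹)
      (bernGen s⁻¹ - τ)]
  have hVb : ∀ s ∈ ball p d₀, ‖V s - 1‖ ≤ 1 / 20 := fun s hs => by
    have h1 := (hball s hs).1.1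
    have e : V s - 1 = (-1) ^ n * (Complex.exp (n * -s) / Complex.exp (n * s)) := by
      have := Complex.exp_ne_zero (n * s)
      simp only [hV, twoExp]; field_simp; ring
    rw [e, norm_mul, norm_pow, norm_neg, norm_one, one_pow, one_mul, norm_div,
      norm_exp_natCast_mul, norm_exp_natCast_mul, ← Real.exp_sub]
    refine le_trans ?_ hn2.le
    rw [← Real.exp_nat_mul]
    apply Real.exp_le_exp.2
    rw [Complex.neg_re]
    nlinarith
  have hWb : ∀ s ∈ ball p d₀, ‖U s / V s - 1‖ ≤ 1 / 2 := fun s hs =>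
    norm_div_sub_one_le (hUb s hs) (hVb s hs)
  have hV0 : ∀ s ∈ ball p d₀, V s ≠ 0 := fun s hs h => by
    have := hVb s hs
    rw [h] at this; norm_num at this
  have hEdiff : DifferentiableOn ℂ E (ball p d₀) := fun s hs => by
    have hUd : DifferentiableAt ℂ U s :=
      (((differentiable_bernSum n s).add (differentiable_twoExp n s)).div
        (differentiable_topTerm n s) (hs0 s hs).2).div_const τ
    have hVd : DifferentiableAt ℂ V s := (differentiable_twoExp n s).div
      (by fun_prop) (Complex.exp_ne_zero _)
    exact (((hUd.div hVd (hV0 s hs)).clog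
      (slitPlane_of_norm_sub_one_le (hWb s hs))).div_const _).differentiableWithinAt
  have hEb : ∀ s ∈ ball p d₀, ‖E s‖ ≤ 1 / n := fun s hs => by
    simp only [hE]
    rw [norm_div, Complex.norm_natCast]
    gcongr
    exact norm_log_le_of_norm_sub_one_le (hWb s hs)
  -- The branch `k` matches the imaginary part to within `π/n`. The real parts match in the limit:
  -- `Re L p = -1` is the arc equation, and `Re (a n) / n → 1`.
  obtain ⟨k, hk⟩ := exists_int_near ((L p).im + (a n).im / n) hn
  have hpball : p ∈ ball p d₀ := mem_ball_self hd₀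
  have hLre : (L p).re = -1 := by
    have h1 := congrArg Real.log hp.2.2
    rw [Real.log_exp, Real.log_mul (Real.exp_pos 1).ne' (norm_ne_zero_iff.2 hp0),
      Real.log_exp] at h1
    simp only [hL, Complex.sub_re, Complex.log_re]
    linarith
  set y : ℂ := 2 * Real.pi * k / n * Complex.I - a n / n with hy
  have hyb : ‖y - (L p + E p)‖ < c / 4 := by
    have hyre : (y - L p).re = -((a n).re / n - 1) := by
      have : y.re = -((a n).re / n) := by
        rw [hy, show (2 * Real.pi * k / n * Complex.I - a n / n : ℂ) =
          ((2 * Real.pi * k / n : ℝ) : ℂ) * Complex.I - a n / ((n : ℝ) : ℂ) by push_cast; rfl]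
        rw [Complex.sub_re, Complex.re_ofReal_mul, Complex.I_re, Complex.div_ofReal_re]
        ring
      rw [Complex.sub_re, this, hLre]; ring
    have hyim : (y - L p).im = 2 * Real.pi * k / n - ((L p).im + (a n).im / n) := by
      have : y.im = 2 * Real.pi * k / n - (a n).im / n := by
        rw [hy, show (2 * Real.pi * k / n * Complex.I - a n / n : ℂ) =
          ((2 * Real.pi * k / n : ℝ) : ℂ) * Complex.I - a n / ((n : ℝ) : ℂ) by push_cast; rfl]
        rw [Complex.sub_im, Complex.im_ofReal_mul, Complex.I_im, Complex.div_ofReal_im]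
        ring
      rw [Complex.sub_im, this]; ring
    have h1 := Complex.norm_le_abs_re_add_abs_im (y - L p)
    rw [hyre, hyim, abs_neg] at h1
    have h2 := norm_sub_le (y - L p) (E p)
    rw [sub_sub] at h2
    have h3 := hEb p hpball
    rw [add_div] at hn4
    linarith
  obtain ⟨s, hs, hsy⟩ := exists_add_eq_of_sphere_bound hdpos hdd hc hLdiff hEdiff hsph
    (fun z hz => (hEb z hz).trans hn3.le) hyb
  have hsb : s ∈ ball p d₀ := closedBall_subset_ball hdd hs
  obtain ⟨hsne, htop⟩ := hs0 s hsb
  refine ⟨s, ?_, (half_pos hre).trans (hball s hsb).1.1, ?_⟩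
  · have hexp : Complex.exp (n * (L s + E s + a n / n)) = 1 := by
      rw [hsy, hy]
      rw [show (n : ℂ) * (2 * Real.pi * k / n * Complex.I - a n / n + a n / n) =
        k * (2 * Real.pi * Complex.I) by field_simp; ring]
      exact Complex.exp_int_mul_two_pi_mul_I k
    have hW0 : U s / V s ≠ 0 := fun h => by
      have := hWb s hsb
      rw [h] at this; norm_num at this
    have hcoef : (((n : ℝ) ^ n / (n.factorial : ℝ) : ℝ) : ℂ) * τ ≠ 0 :=
      mul_ne_zero (Complex.ofReal_ne_zero.2 (by positivity)) hτ0
    have e : (n : ℂ) * (L s + E s + a n / n) =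
        n * Complex.log s + -(n * s) + Complex.log (U s / V s) + a n := by
      simp only [hL, hE]; field_simp; ring
    rw [e, Complex.exp_add, Complex.exp_add, Complex.exp_add, Complex.exp_nat_mul,
      Complex.exp_log hsne, Complex.exp_log hW0, ha, Complex.exp_log hcoef, Complex.exp_neg] at hexp
    have hX := Complex.exp_ne_zero (n * s)
    have htw : twoExp n s ≠ 0 := fun h => hV0 s hsb (by simp [hV, h])
    have htop' : topTerm n s = (((n : ℝ) ^ n / (n.factorial : ℝ) : ℝ) : ℂ) * s ^ n := by
      rw [topTerm, mul_pow]; push_cast; ring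
    have h1 : bernSum n s + twoExp n s = twoExp n s := by
      have h2 : U s / V s = (bernSum n s + twoExp n s) * Complex.exp (n * s) /
          (topTerm n s * τ * twoExp n s) := by
        simp only [hU, hV]; field_simp
      rw [h2] at hexp
      have h3 : (bernSum n s + twoExp n s) / twoExp n s = 1 := by
        rw [← hexp, htop']
        rw [htop'] at htop
        have hf : (((n : ℝ) ^ n / (n.factorial : ℝ) : ℝ) : ℂ) ≠ 0 := left_ne_zero_of_mul hcoef
        field_simp
      exact (div_eq_one_iff_eq htw).1 h3
    simpa using h1
  · rw [mem_closedBall, dist_eq_norm] at hs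
    exact hs.trans_lt ((min_le_right _ _).trans_lt (half_lt_self hε))

end

/-! ### Uniformity along the arc and return to the variable `z` -/

section

open Filter Topology

/-- A finite `ε/3`-net of the arc without its tip makes the pointwise statement uniform; the tip is
covered because it lies in the closure of the rest. -/
theorem eventually_szegoArc_near_zeros {ε : ℝ} (hε : 0 < ε) : ∀ᶠ n : ℕ in atTop,
    ∀ w ∈ szegoArc, ∃ s : ℂ, bernSum n s = 0 ∧ 0 < s.re ∧ ‖s - w‖ < ε := by
  have htb : TotallyBounded (szegoArc \ {1}) :=
    ((ProperSpace.isCompact_closedBall (0 : ℂ) 1).totallyBounded).subset fun s hs => by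
      simpa using hs.1.2.1
  obtain ⟨t, ht, hfin, hcov⟩ := Metric.finite_approx_of_totallyBounded htb (ε / 3) (by positivity)
  have hall : ∀ᶠ n : ℕ in atTop, ∀ p ∈ t, ∃ s : ℂ, bernSum n s = 0 ∧ 0 < s.re ∧ ‖s - p‖ < ε / 3 :=
    (eventually_all_finite hfin).2 fun p hp =>
      eventually_exists_zero_near (ht hp).1 (ht hp).2 (by positivity)
  filter_upwards [hall] with n hn w hw
  have hcl : w ∈ closure (szegoArc \ {1}) := by
    by_cases h : w = 1
    · rw [h]; exact one_mem_closure_szegoArc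
    · exact subset_closure ⟨hw, h⟩
  obtain ⟨w', hw', hd⟩ := Metric.mem_closure_iff.1 hcl (ε / 3) (by positivity)
  obtain ⟨p, hp, hpd⟩ := Set.mem_iUnion₂.1 (hcov hw')
  obtain ⟨s, hs0, hsre, hsd⟩ := hn p hp
  refine ⟨s, hs0, hsre, ?_⟩
  rw [Metric.mem_ball] at hpd
  rw [← dist_eq_norm] at hsd ⊢
  have h1 := dist_triangle s p w
  have h2 := dist_triangle p w' w
  rw [dist_comm p w', dist_comm w' w] at h2
  linarith

lemma mem_rescaledBernoulliZeros_iff (n : ℕ) (z : ℂ) :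
    z ∈ rescaledBernoulliZeros n ↔ bernSum n (-2 * Real.pi * Complex.I * z) = 0 := by
  have hpi : (-2 * (Real.pi : ℂ) * Complex.I) ^ n / (n.factorial : ℂ) ≠ 0 :=
    div_ne_zero (pow_ne_zero _ (by simp [Real.pi_ne_zero])) (by simp [Nat.factorial_ne_zero])
  rw [bernSum_eq_aeval, mul_eq_zero, or_iff_right hpi]
  rfl

lemma conj_mem_rescaledBernoulliZeros {n : ℕ} {z : ℂ} (hz : z ∈ rescaledBernoulliZeros n) :
    (starRingEnd ℂ) z ∈ rescaledBernoulliZeros n := by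
  rw [mem_rescaledBernoulliZeros_iff] at hz ⊢
  have e : -2 * (Real.pi : ℂ) * Complex.I * (starRingEnd ℂ) z =
      -(starRingEnd ℂ) (-2 * Real.pi * Complex.I * z) := by
    simp only [map_mul, map_neg, map_ofNat, Complex.conj_ofReal, Complex.conj_I]
    ring
  rw [e, conj_bernSum, hz, map_zero, mul_zero]

lemma norm_neg_two_pi_I_mul (z : ℂ) :
    ‖-2 * (Real.pi : ℂ) * Complex.I * z‖ = 2 * Real.pi * ‖z‖ := by
  simp [abs_of_pos Real.pi_pos]

lemma neg_two_pi_I_mul_re (z : ℂ) :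
    (-2 * (Real.pi : ℂ) * Complex.I * z).re = 2 * Real.pi * z.im := by
  simp

lemma mem_upperZeroCurve_iff (z : ℂ) :
    z ∈ upperZeroCurve ↔ -2 * (Real.pi : ℂ) * Complex.I * z ∈ szegoArc := by
  have hpi := Real.pi_pos
  simp only [upperZeroCurve, szegoArc, Set.mem_ofPred_eq, norm_neg_two_pi_I_mul,
    neg_two_pi_I_mul_re]
  rw [mul_pos_iff_of_pos_left (by positivity), le_div_iff₀ (by positivity), mul_comm ‖z‖,
    show 2 * Real.pi * Real.exp 1 * ‖z‖ = Real.exp 1 * (2 * Real.pi * ‖z‖) by ring]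

lemma conj_mem_upperZeroCurve_iff (z : ℂ) :
    (starRingEnd ℂ) z ∈ upperZeroCurve ↔ z ∈ lowerZeroCurve := by
  simp [upperZeroCurve, lowerZeroCurve]

lemma eventually_upper {ε : ℝ} (hε : 0 < ε) : ∀ᶠ n : ℕ in atTop,
    (∀ z ∈ rescaledBernoulliZeros n, 0 < z.im → ∃ w ∈ upperZeroCurve, ‖z - w‖ < ε) ∧
    (∀ w ∈ upperZeroCurve, ∃ z ∈ rescaledBernoulliZeros n, 0 < z.im ∧ ‖z - w‖ < ε) := by
  have hpi := Real.pi_pos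
  have ha : (-2 * (Real.pi : ℂ) * Complex.I) ≠ 0 := by simp [Real.pi_ne_zero]
  have hε' : 0 < 2 * Real.pi * ε := by positivity
  have hsurj : ∀ s : ℂ, ∃ z, -2 * (Real.pi : ℂ) * Complex.I * z = s := fun s =>
    ⟨s / (-2 * (Real.pi : ℂ) * Complex.I), mul_div_cancel₀ s ha⟩
  have hdist : ∀ z w : ℂ, ‖-2 * (Real.pi : ℂ) * Complex.I * z -
      -2 * (Real.pi : ℂ) * Complex.I * w‖ < 2 * Real.pi * ε → ‖z - w‖ < ε := fun z w h => by
    rw [← mul_sub, norm_neg_two_pi_I_mul] at h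
    exact lt_of_mul_lt_mul_left h (by positivity)
  filter_upwards [eventually_zeros_near_szegoArc hε', eventually_szegoArc_near_zeros hε']
    with n h1 h2
  constructor
  · intro z hz him
    obtain ⟨s, hs, hd⟩ := h1 _ (by rw [neg_two_pi_I_mul_re]; positivity)
      ((mem_rescaledBernoulliZeros_iff n z).1 hz)
    obtain ⟨w, rfl⟩ := hsurj s
    exact ⟨w, (mem_upperZeroCurve_iff w).2 hs, hdist z w hd⟩
  · intro w hw
    obtain ⟨s, hs, hre, hd⟩ := h2 _ ((mem_upperZeroCurve_iff w).1 hw)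
    obtain ⟨z, rfl⟩ := hsurj s
    rw [neg_two_pi_I_mul_re] at hre
    exact ⟨z, (mem_rescaledBernoulliZeros_iff n z).2 hs,
      (mul_pos_iff_of_pos_left (by positivity)).1 hre, hdist z w hd⟩

end

theorem theorem1p1 :
    ∀ ε : ℝ, 0 < ε → ∃ N : ℕ, ∀ n : ℕ, N ≤ n →
      (∀ z ∈ rescaledBernoulliZeros n, 0 < z.im → ∃ w ∈ upperZeroCurve, ‖z - w‖ < ε) ∧
      (∀ z ∈ rescaledBernoulliZeros n, z.im < 0 → ∃ w ∈ lowerZeroCurve, ‖z - w‖ < ε) ∧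
      (∀ w ∈ upperZeroCurve, ∃ z ∈ rescaledBernoulliZeros n, 0 < z.im ∧ ‖z - w‖ < ε) ∧
      (∀ w ∈ lowerZeroCurve, ∃ z ∈ rescaledBernoulliZeros n, z.im < 0 ∧ ‖z - w‖ < ε) := by
  intro ε hε
  obtain ⟨N, hN⟩ := Filter.eventually_atTop.1 (eventually_upper hε)
  -- Conjugation preserves the zero set and exchanges the two curves, so the lower half-plane
  -- follows with the same `N`.
  have hconj : ∀ z w : ℂ, ‖(starRingEnd ℂ) z - (starRingEnd ℂ) w‖ = ‖z - w‖ := fun z w => by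
    rw [← map_sub, Complex.norm_conj]
  refine ⟨N, fun n hn => ?_⟩
  obtain ⟨h1, h2⟩ := hN n hn
  refine ⟨h1, fun z hz him => ?_, h2, fun w hw => ?_⟩
  · obtain ⟨w, hw, hd⟩ := h1 _ (conj_mem_rescaledBernoulliZeros hz) (by simpa using him)
    refine ⟨(starRingEnd ℂ) w, ?_, ?_⟩
    · rw [← conj_mem_upperZeroCurve_iff, Complex.conj_conj]; exact hw
    · rw [← hconj, Complex.conj_conj]; exact hd
  · obtain ⟨z, hz, him, hd⟩ := h2 _ ((conj_mem_upperZeroCurve_iff w).2 hw)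
    refine ⟨(starRingEnd ℂ) z, conj_mem_rescaledBernoulliZeros hz, by simpa using him, ?_⟩
    rw [← hconj, Complex.conj_conj]; exact hd
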